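/- **Setting.** Let $\underline k\le\bar k$, $\underline u\le\bar u$, and let $k,u_0:\mathbb R\to\mathbb R$ have bounded variation on $\mathbb R$ (i.e. each agrees a.e. with a function of finite total variation), with $k(x)\in[\underline k,\bar k]$ and $u_0(x)\in[\underline u,\bar u]$ for a.e. $x$. Let $f=f(k,u)$ be a flux on $[\underline k,\bar k]\times[\underline u,\bar u]$ such that - for each $k$, $f(k,\cdot)\in C^3[\underline u,\bar u]$ is strictly convex, and $0<\gamma_1\le f_{uu}(k,u)\le\gamma_2$ for all $(k,u)$; - for each $u$, $f(\cdot,u)\in C^2[\underline k,\bar k]$ with $f_{kk}\equiv 0$, and $f_u(\cdot,u)\in C^1[\underline k,\bar k]$; - $f(k_1,\bar u)=f(k_2,\bar u)$ and $f(k_1,\underline u)=f(k_2,\underline u)$ for all $k_1,k_2\in[\underline k,\bar k]$. **Scheme.** Fix $\lambda>0$. For $\Delta x>0$ put $\Delta t=\lambda\Delta x$ and $x_p=p\,\Delta x$. At time level $n$ the grid points are the $x_p$ with $p+\frac n2\in\mathbb Z$. For such $p$ and also for the midpoints, let $k_p=\frac1{\Delta x}\int_{x_{p-1/2}}^{x_{p+1/2}}k\,dx$.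 Set $u^0_j=\frac1{\Delta x}\int_{x_{j-1/2}}^{x_{j+1/2}}u_0\,dx$ and $$u^{n+1}_{j+\frac12}=\tfrac12(u^n_j+u^n_{j+1})-\tfrac18(\sigma^n_{j+1}-\sigma^n_j)-\lambda\big(f(k_{j+1},u^{n+\frac12}_{j+1})-f(k_j,u^{n+\frac12}_j)\big),$$ $$u^{n+\frac12}_j=u^n_j-\tfrac\lambda2 f_u(k_j,u^n_j)\sigma^n_j,\qquad \sigma^n_j=\mathrm{minmod}\big(u^n_{j+1}-u^n_j,\ \tfrac12(u^n_{j+1}-u^n_{j-1}),\ u^n_j-u^n_{j-1}\big),$$ where $j+\frac n2\in\mathbb Z$; $\mathrm{minmod}$ of several numbers is the one of least absolute value if all have the same sign, and $0$ otherwise. Write $\Delta v_{j+\frac12}=v_{j+1}-v_j$, $\beta^n_{j+\frac12}=\lambda f_u\big(\tfrac{k_j+k_{j+1}}2,\tfrac{u^n_j+u^n_{j+1}}2\big)$, and $$\nu^n_{j+\frac12}=\tfrac18\big(1-4(\beta^n_{j+\frac12})^2\big)\Big[1-\tfrac1{16}\big(1-4(\beta^n_{j+\frac12})^2\big)\Big(\tfrac{\Delta\sigma^n_{j+1/2}}{\Delta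 u^n_{j+1/2}}\Big)^2-\beta^n_{j+\frac12}\tfrac{\Delta\sigma^n_{j+1/2}}{\Delta u^n_{j+1/2}}-\tfrac{\sigma^n_{j+1}+\sigma^n_j}{2\Delta u^n_{j+1/2}}\Big]f_{uu}\big(k_{j+\frac12},\tfrac{u^n_j+u^n_{j+1}}2\big),$$ the quotients being read as $0$ when $\Delta u^n_{j+1/2}=0$ (then $\sigma^n_j=\sigma^n_{j+1}=0$). **CFL condition.** With $C=\max\{|\underline u|,|\bar u|\}$, $\chi=228+13C+174C\gamma_2+12C^2\gamma_2$ and $\|f_u\|=\sup_{[\underline k,\bar k]\times[\underline u,\bar u]}|f_u|$, assume for some real $\kappa$ $$\lambda\|f_u\|\le\kappa\le\min\Big\{\frac{\gamma_1}{7500\gamma_2},\ \frac1{4000},\ \frac7{85+16C},\ \frac{\gamma_1}{\gamma_2\chi}\Big\}.$$ **Claim.** (i) $\nu^n_{j+\frac12}\ge0$ for every $\Delta x>0$, every $n\ge0$ and every $j$ with $j+\frac n2\in\mathbb Z$. (ii) For every $T>0$ and every $\Delta_0>0$ there is a constant $K$, independent of $\Delta x$, such that for all $\Delta x\in(0,\Delta_0]$,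 with $N=\lfloor T/\Delta t\rfloor+1$, the inner sums converge and $$\Delta x\sum_{n=0}^{N-1}\ \sum_{j+\frac n2\in\mathbb Z}\nu^n_{j+\frac12}\,(\Delta u^n_{j+\frac12})^2\le K.$$ By (i), the same $K$ bounds the local sums restricted to $|j|\le J=\lfloor X/\Delta x\rfloor+1$, for every $X>0$. -/

import Mathlib

open MeasureTheory Set

noncomputable section

namespace NTScheme

/-- `w` has bounded variation on `ℝ` (as an a.e. class): it agrees almost everywhere with a
function of finite pointwise total variation. No integrability of `w` over `ℝ` is required. -/
def HasBV (w : ℝ → ℝ) : Prop :=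
  ∃ v : ℝ → ℝ, w =ᵐ[volume] v ∧ BoundedVariationOn v univ

/-- The partial derivative `f_u(k, u)` of a flux given on `[uMin, uMax]` (one-sided at the
endpoints). -/
def fluxU (f : ℝ → ℝ → ℝ) (uMin uMax : ℝ) (k u : ℝ) : ℝ :=
  derivWithin (f k) (Icc uMin uMax) u

/-- The second partial derivative `f_uu(k, u)` (one-sided at the endpoints). -/
def fluxUU (f : ℝ → ℝ → ℝ) (uMin uMax : ℝ) (k u : ℝ) : ℝ :=
  iteratedDerivWithin 2 (f k) (Icc uMin uMax) u

/-- The standing hypotheses on the flux `f` over the rectangle `[kMin, kMax] × [uMin, uMax]`. -/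
structure FluxHyp (f : ℝ → ℝ → ℝ) (kMin kMax uMin uMax γ₁ γ₂ : ℝ) : Prop where
  smooth_u : ∀ k ∈ Icc kMin kMax, ContDiffOn ℝ 3 (f k) (Icc uMin uMax)
  strictConvex : ∀ k ∈ Icc kMin kMax, StrictConvexOn ℝ (Icc uMin uMax) (f k)
  gamma_pos : 0 < γ₁
  fuu_bounds : ∀ k ∈ Icc kMin kMax, ∀ u ∈ Icc uMin uMax,
    γ₁ ≤ fluxUU f uMin uMax k u ∧ fluxUU f uMin uMax k u ≤ γ₂
  smooth_k : ∀ u ∈ Icc uMin uMax, ContDiffOn ℝ 2 (fun k => f k u) (Icc kMin kMax)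
  fkk_zero : ∀ u ∈ Icc uMin uMax, ∀ k ∈ Icc kMin kMax,
    iteratedDerivWithin 2 (fun k' => f k' u) (Icc kMin kMax) k = 0
  smooth_fu_k : ∀ u ∈ Icc uMin uMax,
    ContDiffOn ℝ 1 (fun k => fluxU f uMin uMax k u) (Icc kMin kMax)
  eq_at_max : ∀ k₁ ∈ Icc kMin kMax, ∀ k₂ ∈ Icc kMin kMax, f k₁ uMax = f k₂ uMax
  eq_at_min : ∀ k₁ ∈ Icc kMin kMax, ∀ k₂ ∈ Icc kMin kMax, f k₁ uMin = f k₂ uMin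

/-- `C_{u₀} = max(|uMin|, |uMax|)`. -/
def supBound (uMin uMax : ℝ) : ℝ := max |uMin| |uMax|

/-- `χ = 228 + 13 C + 174 C γ₂ + 12 C² γ₂`. -/
def chi (C γ₂ : ℝ) : ℝ := 228 + 13 * C + 174 * C * γ₂ + 12 * C ^ 2 * γ₂

/-- The CFL condition `lam ‖f_u‖ ≤ κ ≤ min {...}`, the norm being the supremum over the rectangle
`[kMin, kMax] × [uMin, uMax]`. -/
def CFL (f : ℝ → ℝ → ℝ) (kMin kMax uMin uMax γ₁ γ₂ lam κ : ℝ) : Prop :=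
  (∀ k ∈ Icc kMin kMax, ∀ u ∈ Icc uMin uMax, lam * |fluxU f uMin uMax k u| ≤ κ) ∧
  κ ≤ γ₁ / (7500 * γ₂) ∧
  κ ≤ 1 / 4000 ∧
  κ ≤ 7 / (85 + 16 * supBound uMin uMax) ∧
  κ ≤ γ₁ / (γ₂ * chi (supBound uMin uMax) γ₂)

/-- Three-argument minmod. -/
def minmod (a b c : ℝ) : ℝ :=
  if Real.sign a = Real.sign b ∧ Real.sign b = Real.sign c then
    Real.sign a * min |a| (min |b| |c|)
  else 0

/-- The mean of `w` over the cell of width `dx` centred at `p * dx`. -/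
def cellAvg (w : ℝ → ℝ) (dx p : ℝ) : ℝ :=
  (1 / dx) * ∫ x in ((p - 1 / 2) * dx)..((p + 1 / 2) * dx), w x

/-- The limited slopes `σ_j` of a grid function. -/
def slope (v : ℤ → ℝ) (j : ℤ) : ℝ :=
  minmod (v (j + 1) - v j) ((v (j + 1) - v (j - 1)) / 2) (v j - v (j - 1))

/-- Mid-time values `v_j - (lam / 2) f_u(kk_j, v_j) σ_j`, for coefficient values `kk`. -/
def midValue (f : ℝ → ℝ → ℝ) (uMin uMax lam : ℝ) (kk v : ℤ → ℝ) (j : ℤ) : ℝ :=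
  v j - lam / 2 * fluxU f uMin uMax (kk j) (v j) * slope v j

/-- One step of the staggered second-order scheme; entry `j` of the result is the new value at the
midpoint between the grid points number `j` and `j + 1`. -/
def step (f : ℝ → ℝ → ℝ) (uMin uMax lam : ℝ) (kk v : ℤ → ℝ) (j : ℤ) : ℝ :=
  (v j + v (j + 1)) / 2 - (slope v (j + 1) - slope v j) / 8
    - lam * (f (kk (j + 1)) (midValue f uMin uMax lam kk v (j + 1))
        - f (kk j) (midValue f uMin uMax lam kk v j))

/-- Discretized coefficient on the time-level-`n` grid: entry `j` is the mean of `k` over the cell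
centred at `(j + n / 2) * dx`. -/
def coeff (k : ℝ → ℝ) (dx : ℝ) (n : ℕ) (j : ℤ) : ℝ :=
  cellAvg k dx ((j : ℝ) + (n : ℝ) / 2)

/-- The numerical solution. Entry `(n, j)` is the value at time level `n` at the grid point
`(j + n / 2) * dx`, so the indices of level `n` run exactly through the points `p * dx` with
`p + n / 2` an integer. -/
def sol (f : ℝ → ℝ → ℝ) (uMin uMax : ℝ) (k u₀ : ℝ → ℝ) (lam dx : ℝ) : ℕ → ℤ → ℝ
  | 0 => fun j => cellAvg u₀ dx (j : ℝ)
  | n + 1 => step f uMin uMax lam (coeff k dx n) (sol f uMin uMax k u₀ lam dx n)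

/-- The increment `v_{j+1} - v_j`. -/
def diff (v : ℤ → ℝ) (j : ℤ) : ℝ := v (j + 1) - v j

/-- `β = lam * f_u(k̃, ũ)` with `k̃`, `ũ` the means of the values at the grid points `j`, `j + 1`. -/
def beta (f : ℝ → ℝ → ℝ) (uMin uMax lam : ℝ) (kk v : ℤ → ℝ) (j : ℤ) : ℝ :=
  lam * fluxU f uMin uMax ((kk j + kk (j + 1)) / 2) ((v j + v (j + 1)) / 2)

/-- The weight `ν` at the midpoint between the grid points `j` and `j + 1`; `kMid` is the mean of
`k` over the cell between these two points. If the increment of `v` vanishes, both slopes vanish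
and the quotients are read as `0`. -/
def weight (f : ℝ → ℝ → ℝ) (uMin uMax lam : ℝ) (kk v : ℤ → ℝ) (kMid : ℝ) (j : ℤ) : ℝ :=
  1 / 8 * (1 - 4 * beta f uMin uMax lam kk v j ^ 2) *
    (1 - 1 / 16 * (1 - 4 * beta f uMin uMax lam kk v j ^ 2)
          * (diff (slope v) j / diff v j) ^ 2
      - beta f uMin uMax lam kk v j * (diff (slope v) j / diff v j)
      - (slope v (j + 1) + slope v j) / (2 * diff v j)) *
    fluxUU f uMin uMax kMid ((v j + v (j + 1)) / 2)

/-- The weight `ν` at time level `n`, at the point `(j + n / 2 + 1 / 2) * dx`. -/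
def nu (f : ℝ → ℝ → ℝ) (uMin uMax : ℝ) (k u₀ : ℝ → ℝ) (lam dx : ℝ) (n : ℕ) (j : ℤ) : ℝ :=
  weight f uMin uMax lam (coeff k dx n) (sol f uMin uMax k u₀ lam dx n)
    (cellAvg k dx ((j : ℝ) + (n : ℝ) / 2 + 1 / 2)) j

end NTScheme

end

/-!
The argument is an entropy estimate for the quadratic entropy `u ^ 2 / 2`. In each cell, the entropy
produced by one step is a telescoping difference of numerical entropy fluxes, minus a multiple of
`Δu ^ 2 - (σ₀ + σ₁) Δu / 2`, plus an error proportional to the variation of the coefficient over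
the cell. By convexity `λ f_u` is monotone in `u`, so subtracting `4 λ f_u(u) σ |σ|` from the
entropy flux yields a viscous gain that absorbs the terms caused by the variation of `λ f_u` over a
cell. Since `ν Δu ^ 2` is at most a multiple of the dissipated quantity, it remains to bound the
drop of the entropy over a window of cells. The initial data need not be square integrable, so the
drop is bounded by `∑ U₀ (U₀ - U_N)`; the scheme is in conservation form, and summation by parts
against `U₀`, which has bounded variation, leaves a bound of order `N` that does not depend on the
window. The values stay in `[uMin, uMax]` because the endpoints are stationary states for every
value of the coefficient.
-/

noncomputable section

namespace NTScheme

section BoundedLipschitz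

variable {X α β : Type*} [PseudoMetricSpace X] {G H : X → α → ℝ} {K : Set X} {A : Set α}

/-- The functions `x ↦ G x a`, for `a ∈ A`, are bounded and Lipschitz on `K` with a common
constant. This is what is needed of the dependence of the flux on the coefficient `x`. -/
def BoundedLipschitzOn (G : X → α → ℝ) (K : Set X) (A : Set α) : Prop :=
  ∃ C, 0 ≤ C ∧ ∀ a ∈ A, ∀ x ∈ K, |G x a| ≤ C ∧ ∀ y ∈ K, |G x a - G y a| ≤ C * dist x y

namespace BoundedLipschitzOn

theorem of_abs_le {φ : α → ℝ} {B : ℝ} (hφ : ∀ a ∈ A, |φ a| ≤ B) :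
    BoundedLipschitzOn (fun _ => φ) K A :=
  ⟨max B 0, le_max_right _ _, fun a ha x _ => ⟨(hφ a ha).trans (le_max_left _ _), fun y _ => by
    rw [sub_self, abs_zero]
    exact mul_nonneg (le_max_right _ _) dist_nonneg⟩⟩

theorem congr (hG : BoundedLipschitzOn G K A) (hGH : ∀ x ∈ K, ∀ a ∈ A, G x a = H x a) :
    BoundedLipschitzOn H K A := by
  obtain ⟨C, hC, hG⟩ := hG
  refine ⟨C, hC, fun a ha x hx => ⟨hGH x hx a ha ▸ (hG a ha x hx).1, fun y hy => ?_⟩⟩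
  rw [← hGH x hx a ha, ← hGH y hy a ha]
  exact (hG a ha x hx).2 y hy

theorem comp_right (hG : BoundedLipschitzOn G K A) {φ : β → α} {B : Set β} (hφ : MapsTo φ B A) :
    BoundedLipschitzOn (fun x b => G x (φ b)) K B := by
  obtain ⟨C, hC, hG⟩ := hG
  exact ⟨C, hC, fun b hb => hG (φ b) (hφ hb)⟩

theorem add (hG : BoundedLipschitzOn G K A) (hH : BoundedLipschitzOn H K A) :
    BoundedLipschitzOn (fun x a => G x a + H x a) K A := by
  obtain ⟨C, hC, hG⟩ := hG
  obtain ⟨D, hD, hH⟩ := hH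
  refine ⟨C + D, add_nonneg hC hD, fun a ha x hx => ⟨?_, fun y hy => ?_⟩⟩
  · exact (abs_add_le _ _).trans (add_le_add (hG a ha x hx).1 (hH a ha x hx).1)
  · rw [add_sub_add_comm, add_mul]
    exact (abs_add_le _ _).trans (add_le_add ((hG a ha x hx).2 y hy) ((hH a ha x hx).2 y hy))

theorem mul (hG : BoundedLipschitzOn G K A) (hH : BoundedLipschitzOn H K A) :
    BoundedLipschitzOn (fun x a => G x a * H x a) K A := by
  obtain ⟨C, hC, hG⟩ := hG
  obtain ⟨D, hD, hH⟩ := hH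
  refine ⟨C * D + C * D, by positivity, fun a ha x hx => ⟨?_, fun y hy => ?_⟩⟩
  · have hle : |G x a| * |H x a| ≤ C * D :=
      mul_le_mul (hG a ha x hx).1 (hH a ha x hx).1 (abs_nonneg _) hC
    rw [abs_mul]
    linarith [mul_nonneg hC hD]
  · calc |G x a * H x a - G y a * H y a|
        = |G x a * (H x a - H y a) + (G x a - G y a) * H y a| := by ring_nf
      _ ≤ |G x a| * |H x a - H y a| + |G x a - G y a| * |H y a| := by
        rw [← abs_mul, ← abs_mul]; exact abs_add_le _ _
      _ ≤ C * (D * dist x y) + C * dist x y * D := by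
        gcongr
        exacts [(hG a ha x hx).1, (hH a ha x hx).2 y hy, (hG a ha x hx).2 y hy, (hH a ha y hy).1]
      _ = (C * D + C * D) * dist x y := by ring

theorem const_mul (c : ℝ) (hG : BoundedLipschitzOn G K A) :
    BoundedLipschitzOn (fun x a => c * G x a) K A :=
  (of_abs_le (φ := fun _ => c) fun _ _ => le_rfl).mul hG

theorem sub (hG : BoundedLipschitzOn G K A) (hH : BoundedLipschitzOn H K A) :
    BoundedLipschitzOn (fun x a => G x a - H x a) K A :=
  (hG.add (hH.const_mul (-1))).congr fun _ _ _ _ => by ring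

theorem comp_of_lipschitz {G : X → ℝ → ℝ} {m : X → α → ℝ} {I : Set ℝ} {L : ℝ}
    (hG : BoundedLipschitzOn G K I) (hm : BoundedLipschitzOn m K A)
    (hmem : ∀ x ∈ K, ∀ a ∈ A, m x a ∈ I)
    (hL : ∀ x ∈ K, ∀ u ∈ I, ∀ v ∈ I, |G x u - G x v| ≤ L * |u - v|) :
    BoundedLipschitzOn (fun x a => G x (m x a)) K A := by
  obtain ⟨C, hC, hG⟩ := hG
  obtain ⟨D, hD, hm⟩ := hm
  refine ⟨C + |L| * D, by positivity, fun a ha x hx => ⟨?_, fun y hy => ?_⟩⟩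
  · exact (hG _ (hmem x hx a ha) x hx).1.trans (le_add_of_nonneg_right (by positivity))
  · calc |G x (m x a) - G y (m y a)|
        ≤ |G x (m x a) - G y (m x a)| + |G y (m x a) - G y (m y a)| := abs_sub_le _ _ _
      _ ≤ C * dist x y + |L| * (D * dist x y) := by
        gcongr
        · exact (hG _ (hmem x hx a ha) x hx).2 y hy
        · calc |G y (m x a) - G y (m y a)|
              ≤ L * |m x a - m y a| := hL y hy _ (hmem x hx a ha) _ (hmem y hy a ha)
            _ ≤ |L| * (D * dist x y) :=
              mul_le_mul (le_abs_self L) ((hm a ha x hx).2 y hy) (abs_nonneg _) (abs_nonneg _)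
      _ = (C + |L| * D) * dist x y := by ring

theorem integral {G : X → ℝ → ℝ} {a b : ℝ} (hG : BoundedLipschitzOn G K (Icc a b))
    (hcont : ∀ x ∈ K, ContinuousOn (G x) (Icc a b)) :
    BoundedLipschitzOn (fun x y => ∫ z in a..y, G x z) K (Icc a b) := by
  obtain ⟨C, hC, hG⟩ := hG
  have integrable {x : X} (hx : x ∈ K) {y : ℝ} (hy : y ∈ Icc a b) :
      IntervalIntegrable (G x) volume a y :=
    ((hcont x hx).mono (Icc_subset_Icc_right hy.2)).intervalIntegrable_of_Icc hy.1
  have norm_integral_le {φ : ℝ → ℝ} {M : ℝ} (hM : 0 ≤ M) (hφ : ∀ z ∈ Icc a b, |φ z| ≤ M) {y : ℝ}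
      (hy : y ∈ Icc a b) : |∫ z in a..y, φ z| ≤ M * |b - a| := by
    have hle : ‖∫ z in a..y, φ z‖ ≤ M * |y - a| :=
      intervalIntegral.norm_integral_le_of_norm_le_const fun z hz => by
        rw [uIoc_of_le hy.1] at hz
        exact hφ z ⟨hz.1.le, hz.2.trans hy.2⟩
    refine hle.trans (mul_le_mul_of_nonneg_left ?_ hM)
    exact abs_le_abs_of_nonneg (sub_nonneg.2 hy.1) (sub_le_sub_right hy.2 a)
  refine ⟨C * |b - a|, by positivity, fun y hy x hx => ⟨?_, fun x' hx' => ?_⟩⟩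
  · exact norm_integral_le hC (fun z hz => (hG z hz x hx).1) hy
  · rw [← intervalIntegral.integral_sub (integrable hx hy) (integrable hx' hy),
      mul_right_comm]
    exact norm_integral_le (mul_nonneg hC dist_nonneg) (fun z hz => (hG z hz x hx).2 x' hx') hy

theorem of_affine {G : ℝ → α → ℝ} {a b B : ℝ}
    (hG : ∀ k ∈ Icc a b, ∀ u ∈ A, G k u = G a u + (k - a) / (b - a) * (G b u - G a u))
    (ha : ∀ u ∈ A, |G a u| ≤ B) (hb : ∀ u ∈ A, |G b u| ≤ B) :
    BoundedLipschitzOn G (Icc a b) A := by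
  have weight_bounded : BoundedLipschitzOn (fun k (_ : α) => (k - a) / (b - a)) (Icc a b) A := by
    refine ⟨1 + |(b - a)⁻¹|, by positivity, fun _ _ k hk => ⟨?_, fun y _ => ?_⟩⟩
    · rw [abs_of_nonneg (div_nonneg (sub_nonneg.2 hk.1) (sub_nonneg.2 (hk.1.trans hk.2)))]
      have hle : (k - a) / (b - a) ≤ 1 :=
        div_le_one_of_le₀ (sub_le_sub_right hk.2 a) (sub_nonneg.2 (hk.1.trans hk.2))
      linarith [abs_nonneg (b - a)⁻¹]
    · rw [← sub_div, sub_sub_sub_cancel_right, div_eq_mul_inv, abs_mul, Real.dist_eq, mul_comm]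
      gcongr
      exact le_add_of_nonneg_left zero_le_one
  exact ((of_abs_le ha).add (weight_bounded.mul ((of_abs_le hb).sub (of_abs_le ha)))).congr
    fun k hk u hu => (hG k hk u hu).symm

end BoundedLipschitzOn

end BoundedLipschitz

section Subgradient

/-- `p x` is the slope of a line supporting the graph of `h` over `s` from below at `x`, for every
`x ∈ s`. For a convex flux `h` this is all that is used of the derivative `p`. -/
def IsSubgradientOn (h p : ℝ → ℝ) (s : Set ℝ) : Prop :=
  ∀ x ∈ s, ∀ y ∈ s, h x + p x * (y - x) ≤ h y

namespace IsSubgradientOn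

variable {h p : ℝ → ℝ} {s : Set ℝ} {x y z : ℝ}

theorem monotoneOn (hp : IsSubgradientOn h p s) : MonotoneOn p s := by
  intro x hx y hy hxy
  rcases hxy.eq_or_lt with rfl | hlt
  · rfl
  · nlinarith [hp x hx y hy, hp y hy x hx]

theorem exists_secant_slope (hp : IsSubgradientOn h p s) (hx : x ∈ s) (hy : y ∈ s) :
    ∃ q ∈ uIcc (p x) (p y), h y - h x = q * (y - x) := by
  rcases eq_or_ne x y with rfl | hne
  · exact ⟨p x, left_mem_uIcc, by simp⟩
  refine ⟨(h y - h x) / (y - x), ?_, by rw [div_mul_cancel₀ _ (sub_ne_zero.2 hne.symm)]⟩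
  have below := hp x hx y hy
  have above := hp y hy x hx
  rcases hne.lt_or_gt with hlt | hgt
  · refine mem_uIcc_of_le ?_ ?_
    · rw [le_div_iff₀ (sub_pos.2 hlt)]; linarith
    · rw [div_le_iff₀ (sub_pos.2 hlt)]; linarith
  · refine mem_uIcc_of_ge ?_ ?_
    · rw [le_div_iff_of_neg (sub_neg.2 hgt)]; linarith
    · rw [div_le_iff_of_neg (sub_neg.2 hgt)]; linarith

theorem abs_sub_le (hp : IsSubgradientOn h p s) {κ : ℝ} (hκ : ∀ u ∈ s, |p u| ≤ κ) (hx : x ∈ s)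
    (hy : y ∈ s) : |h y - h x| ≤ κ * |y - x| := by
  obtain ⟨q, hq, heq⟩ := hp.exists_secant_slope hx hy
  rw [heq, abs_mul]
  gcongr
  have hmem : uIcc (p x) (p y) ⊆ Icc (-κ) κ :=
    uIcc_subset_Icc (abs_le.1 (hκ x hx)) (abs_le.1 (hκ y hy))
  exact abs_le.2 (hmem hq)

theorem continuousOn (hp : IsSubgradientOn h p s) {κ : ℝ} (hκ : ∀ u ∈ s, |p u| ≤ κ) :
    ContinuousOn h s :=
  (LipschitzOnWith.of_dist_le_mul (K := κ.toNNReal) fun x hx y hy => by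
    rw [Real.dist_eq, Real.dist_eq]
    refine (hp.abs_sub_le hκ hy hx).trans ?_
    gcongr
    exact le_max_left _ _).continuousOn

theorem remainder_nonneg (hp : IsSubgradientOn h p s) (hx : x ∈ s) (hz : z ∈ s) :
    0 ≤ h z - h x - p x * (z - x) := by
  linarith [hp x hx z hz]

theorem remainder_le (hp : IsSubgradientOn h p s) (hx : x ∈ s) (hz : z ∈ s) :
    h z - h x - p x * (z - x) ≤ |p z - p x| * |z - x| := by
  rw [← abs_mul]
  linarith [hp z hz x hx, le_abs_self ((p z - p x) * (z - x))]

/-- The error is `∫ z in x..y, (r y / 2 - r z)`, where the remainder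
`r z = h z - h x - p x * (z - x)` takes values between `0` and `|p y - p x| * |y - x|`. -/
theorem abs_trapezoid_sub_integral_le [s.OrdConnected] (hp : IsSubgradientOn h p s)
    (hcont : ContinuousOn h s) (hx : x ∈ s) (hy : y ∈ s) :
    |(y - x) * ((h x + h y) / 2) - ∫ z in x..y, h z| ≤ |p y - p x| * (y - x) ^ 2 := by
  have hsub : uIcc x y ⊆ s := OrdConnected.uIcc_subset ‹_› hx hy
  have error_eq : (y - x) * ((h x + h y) / 2) - ∫ z in x..y, h z
      = ∫ z in x..y, ((h y - h x - p x * (y - x)) / 2 - (h z - h x - p x * (z - x))) := by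
    have h_integrable : IntervalIntegrable h volume x y := (hcont.mono hsub).intervalIntegrable
    have lin_integrable : IntervalIntegrable (fun z => p x * (z - x)) volume x y :=
      (by fun_prop : Continuous fun z => p x * (z - x)).intervalIntegrable x y
    rw [intervalIntegral.integral_sub intervalIntegrable_const
        ((h_integrable.sub intervalIntegrable_const).sub lin_integrable),
      intervalIntegral.integral_sub (h_integrable.sub intervalIntegrable_const)
        lin_integrable,
      intervalIntegral.integral_sub h_integrable intervalIntegrable_const,
      intervalIntegral.integral_const_mul,
      intervalIntegral.integral_sub intervalIntegral.intervalIntegrable_id intervalIntegrable_const]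
    simp only [intervalIntegral.integral_const, integral_id, smul_eq_mul]
    ring
  have integrand_le (z : ℝ) (hz : z ∈ uIcc x y) :
      ‖(h y - h x - p x * (y - x)) / 2 - (h z - h x - p x * (z - x))‖
        ≤ |p y - p x| * |y - x| := by
    have remainder_z : h z - h x - p x * (z - x) ≤ |p y - p x| * |y - x| := by
      refine (hp.remainder_le hx (hsub hz)).trans ?_
      gcongr ?_ * ?_
      · exact abs_sub_left_of_mem_uIcc ((hp.monotoneOn.mono hsub).mapsTo_uIcc hz)
      · exact abs_sub_left_of_mem_uIcc hz
    rw [Real.norm_eq_abs, abs_le]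
    constructor <;> linarith [hp.remainder_nonneg hx (hsub hz), hp.remainder_nonneg hx hy,
      hp.remainder_le hx hy]
  calc |(y - x) * ((h x + h y) / 2) - ∫ z in x..y, h z|
      ≤ |p y - p x| * |y - x| * |y - x| := by
        rw [error_eq]
        exact intervalIntegral.norm_integral_le_of_norm_le_const
          fun z hz => integrand_le z (uIoc_subset_uIcc hz)
    _ = |p y - p x| * (y - x) ^ 2 := by rw [mul_assoc, ← sq, sq_abs]

end IsSubgradientOn

end Subgradient

section CellEnergy

theorem abs_mul_le_mul {R : Type*} [CommRing R] [LinearOrder R] [IsStrictOrderedRing R]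
    {x y A B : R} (hx : |x| ≤ A) (hy : |y| ≤ B) : |x * y| ≤ A * B := by
  rw [abs_mul]
  exact mul_le_mul hx hy (abs_nonneg y) ((abs_nonneg x).trans hx)

theorem abs_sub_le_two_sub_add {s t : ℝ} (hs : s ∈ Icc (0 : ℝ) 1) (ht : t ∈ Icc (0 : ℝ) 1) :
    |s - t| ≤ 2 - (s + t) := by
  rw [abs_le]
  constructor <;> linarith [hs.2, ht.2]

theorem sq_sub_le_two_sub_add {s t : ℝ} (hs : s ∈ Icc (0 : ℝ) 1) (ht : t ∈ Icc (0 : ℝ) 1) :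
    (s - t) ^ 2 ≤ 2 - (s + t) := by
  have abs_le_one : |s - t| ≤ 1 := abs_sub_le_of_nonneg_of_le hs.1 hs.2 ht.1 ht.2
  rw [← sq_abs]
  nlinarith [abs_sub_le_two_sub_add hs ht, abs_nonneg (s - t)]

/-- Pairs (value, slope) for which the linear reconstruction on a cell of twice the width stays in
`[a, b]`; these are the data the scheme reads off at a grid point. -/
def nodeStates (a b : ℝ) : Set (ℝ × ℝ) :=
  {z | z.1 - z.2 ∈ Icc a b ∧ z.1 + z.2 ∈ Icc a b}

/-- The mid-time value at a node with (value, slope) `z`, for a flux with `λ f_u = p`. -/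
def midVal (p : ℝ → ℝ) (z : ℝ × ℝ) : ℝ :=
  z.1 - p z.1 / 2 * z.2

/-- The numerical flux at a node with (value, slope) `z`, for `h = λ f` and `p = λ f_u`: one step
takes the values `z₀.1`, `z₁.1` at adjacent nodes to `z₀.1 + numFlux h p z₁ - numFlux h p z₀`. -/
def numFlux (h p : ℝ → ℝ) (z : ℝ × ℝ) : ℝ :=
  z.1 / 2 - z.2 / 8 - h (midVal p z)

/-- The numerical entropy flux for the entropy `u ^ 2 / 2`, for `h = λ f` and `p = λ f_u`. The
integral term is the exact entropy flux at the mid-time value, and the last one is an artificial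
viscosity which absorbs the variation of `p` across a cell. -/
def entropyFlux (h p : ℝ → ℝ) (c : ℝ) (z : ℝ × ℝ) : ℝ :=
  z.1 * z.2 / 8 + (midVal p z * h (midVal p z) - ∫ u in c..midVal p z, h u)
    - 4 * (p z.1 * (z.2 * |z.2|))

theorem add_mul_mem_Icc_of_mem_nodeStates {a b c : ℝ} {z : ℝ × ℝ} (hz : z ∈ nodeStates a b)
    (hc : |c| ≤ 1) : z.1 + c * z.2 ∈ Icc a b := by
  obtain ⟨hc₀, hc₁⟩ := abs_le.1 hc
  have hmem := convex_Icc a b hz.1 hz.2 (a := (1 - c) / 2) (b := (1 + c) / 2) (by linarith)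
    (by linarith) (by ring)
  convert hmem using 1
  simp only [smul_eq_mul]
  ring

theorem fst_mem_Icc_of_mem_nodeStates {a b : ℝ} {z : ℝ × ℝ} (hz : z ∈ nodeStates a b) :
    z.1 ∈ Icc a b := by
  simpa using add_mul_mem_Icc_of_mem_nodeStates hz (c := 0) (by simp)

/-- A scaled flux `h = λ f` with `p = λ f_u`, for a fixed value of the coefficient, under a CFL
condition with constant `κ`. By `slow_variation`, moving a node to its mid-time value changes `p`
by little compared with the variation of `p` across a cell. -/
structure IsCFLFlux (h p : ℝ → ℝ) (a b κ : ℝ) : Prop where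
  kappa_le : κ ≤ 1 / 200
  isSubgradientOn : IsSubgradientOn h p (Icc a b)
  abs_deriv_le : ∀ u ∈ Icc a b, |p u| ≤ κ
  slow_variation : ∀ u ∈ Icc a b, ∀ v ∈ Icc a b, ∀ m ∈ Icc a b,
    |m - u| ≤ κ / 2 * |v - u| → |p m - p u| ≤ |p v - p u| / 4

namespace IsCFLFlux

variable {h p : ℝ → ℝ} {a b κ : ℝ}

theorem continuousOn (H : IsCFLFlux h p a b κ) : ContinuousOn h (Icc a b) :=
  H.isSubgradientOn.continuousOn H.abs_deriv_le

theorem midVal_mem (H : IsCFLFlux h p a b κ) {z : ℝ × ℝ} (hz : z ∈ nodeStates a b) :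
    midVal p z ∈ Icc a b := by
  have hp := H.abs_deriv_le _ (fst_mem_Icc_of_mem_nodeStates hz)
  have hmem := add_mul_mem_Icc_of_mem_nodeStates hz (c := -(p z.1 / 2)) (by
    rw [abs_neg, abs_div, abs_two]
    linarith [H.kappa_le])
  convert hmem using 1
  rw [midVal]
  ring

theorem abs_midVal_sub_le (H : IsCFLFlux h p a b κ) {z : ℝ × ℝ} (hz : z.1 ∈ Icc a b) :
    |midVal p z - z.1| ≤ κ / 2 * |z.2| := by
  have heq : midVal p z - z.1 = -(p z.1 / 2 * z.2) := by rw [midVal]; ring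
  rw [heq, abs_neg, abs_mul, abs_div, abs_two]
  gcongr
  exact H.abs_deriv_le _ hz

end IsCFLFlux

theorem energy_identity {u₀ u₁ σ₀ σ₁ p₀ p₁ m₀ m₁ h₀ h₁ I₀ I₁ : ℝ}
    (hm₀ : m₀ = u₀ - p₀ / 2 * σ₀) (hm₁ : m₁ = u₁ - p₁ / 2 * σ₁) :
    (u₀ + (u₁ / 2 - σ₁ / 8 - h₁) - (u₀ / 2 - σ₀ / 8 - h₀)) ^ 2 / 2 - (u₀ ^ 2 + u₁ ^ 2) / 4
        + (u₁ * σ₁ / 8 + (m₁ * h₁ - I₁)) - (u₀ * σ₀ / 8 + (m₀ * h₀ - I₀))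
      = -((u₁ - u₀) ^ 2 / 8) + (u₁ - u₀) * (σ₀ + σ₁) / 16 + (σ₁ - σ₀) ^ 2 / 128
        + (h₁ - h₀) * ((σ₁ - σ₀) / 8 - (p₁ * σ₁ + p₀ * σ₀) / 4 + (h₁ - h₀) / 2)
        + ((m₁ - m₀) * ((h₀ + h₁) / 2) - (I₁ - I₀)) := by
  subst hm₀ hm₁
  ring

variable {s t p₀ p₁ κ d : ℝ}

theorem abs_slope_correction_le (hs : s ∈ Icc (0 : ℝ) 1) (ht : t ∈ Icc (0 : ℝ) 1)
    (hp₀ : |p₀| ≤ κ) (hp₁ : |p₁| ≤ κ) : |(p₁ * s - p₀ * t) / 2| ≤ κ := by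
  have h₁ : |p₁ * s| ≤ κ * 1 := abs_mul_le_mul hp₁ (abs_le.2 ⟨by linarith [hs.1], hs.2⟩)
  have h₀ : |p₀ * t| ≤ κ * 1 := abs_mul_le_mul hp₀ (abs_le.2 ⟨by linarith [ht.1], ht.2⟩)
  rw [abs_div, abs_two]
  linarith [abs_sub (p₁ * s) (p₀ * t)]

theorem abs_flux_factor_le {P : ℝ} (hs : s ∈ Icc (0 : ℝ) 1) (ht : t ∈ Icc (0 : ℝ) 1)
    (hκ : κ ≤ 1 / 200) (hp₀ : |p₀| ≤ κ) (hP : |P| ≤ κ)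
    (hP₀ : |P - p₀| ≤ 5 / 4 * |p₁ - p₀|) (hP₁ : |P - p₁| ≤ 5 / 4 * |p₁ - p₀|) :
    |(s - t) / 8 - (p₁ * s + p₀ * t) / 4 + P * (1 - (p₁ * s - p₀ * t) / 2) / 2|
      ≤ (1 - (s + t) / 2) / 2 + 2 * |p₁ - p₀| := by
  have abs_s : |s| ≤ 1 := abs_le.2 ⟨by linarith [hs.1], hs.2⟩
  have abs_t : |t| ≤ 1 := abs_le.2 ⟨by linarith [ht.1], ht.2⟩
  have hw : 0 ≤ 2 - (s + t) := by linarith [hs.2, ht.2]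
  have hst := abs_sub_le_two_sub_add hs ht
  have gap_term : |P * (2 - (s + t))| ≤ κ * (2 - (s + t)) :=
    abs_mul_le_mul hP (abs_of_nonneg hw).le
  have secant₁ : |(P - p₁) * s| ≤ 5 / 4 * |p₁ - p₀| * 1 := abs_mul_le_mul hP₁ abs_s
  have secant₀ : |(P - p₀) * t| ≤ 5 / 4 * |p₁ - p₀| * 1 := abs_mul_le_mul hP₀ abs_t
  have correction : |(p₁ - p₀) * s + p₀ * (s - t)| ≤ |p₁ - p₀| * 1 + κ * (2 - (s + t)) :=
    (abs_add_le _ _).trans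
      (add_le_add (abs_mul_le_mul le_rfl abs_s) (abs_mul_le_mul hp₀ hst))
  have quadratic_term : |P * ((p₁ - p₀) * s + p₀ * (s - t))|
      ≤ 1 * (|p₁ - p₀| * 1 + κ * (2 - (s + t))) :=
    abs_mul_le_mul (hP.trans (hκ.trans (by norm_num))) correction
  have hκw : κ * (2 - (s + t)) ≤ 1 / 200 * (2 - (s + t)) := mul_le_mul_of_nonneg_right hκ hw
  have decomposition :
      (s - t) / 8 - (p₁ * s + p₀ * t) / 4 + P * (1 - (p₁ * s - p₀ * t) / 2) / 2
        = (s - t) / 8 + P * (2 - (s + t)) / 4 + ((P - p₁) * s + (P - p₀) * t) / 4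
          - P * ((p₁ - p₀) * s + p₀ * (s - t)) / 4 := by ring
  rw [decomposition]
  rw [abs_le] at *
  constructor <;> linarith [abs_nonneg (p₁ - p₀)]

theorem sub_le_viscosity (hs : s ∈ Icc (0 : ℝ) 1) (ht : t ∈ Icc (0 : ℝ) 1) (hp₀ : |p₀| ≤ κ)
    (hp₁ : |p₁| ≤ κ) (hmono : 0 ≤ (p₁ - p₀) * d) :
    (|p₁ - p₀| - 4 * κ * (1 - (s + t) / 2)) * d ^ 2
      ≤ p₁ * (s * d * |s * d|) - p₀ * (t * d * |t * d|) := by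
  have loss {q r : ℝ} (hq : |q| ≤ κ) (hr : r ∈ Icc (0 : ℝ) 1) :
      |q * ((1 - r ^ 2) * (d * |d|))| ≤ κ * (2 * (1 - r) * d ^ 2) := by
    refine abs_mul_le_mul hq (abs_mul_le_mul ?_ ?_)
    · rw [abs_of_nonneg] <;> nlinarith [hr.1, hr.2]
    · rw [abs_mul, abs_abs, abs_mul_abs_self, sq]
  have main_term : (p₁ - p₀) * (d * |d|) = |p₁ - p₀| * d ^ 2 := by
    rw [← mul_assoc, ← abs_of_nonneg hmono, abs_mul, mul_assoc, abs_mul_abs_self, sq]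
  have decomposition : p₁ * (s * d * |s * d|) - p₀ * (t * d * |t * d|)
      = (p₁ - p₀) * (d * |d|) - p₁ * ((1 - s ^ 2) * (d * |d|))
        + p₀ * ((1 - t ^ 2) * (d * |d|)) := by
    rw [abs_mul s, abs_mul t, abs_of_nonneg hs.1, abs_of_nonneg ht.1]
    ring
  rw [decomposition, main_term]
  linarith [(abs_le.1 (loss hp₁ hs)).2, (abs_le.1 (loss hp₀ ht)).1]

theorem quadratic_part_le (hs : s ∈ Icc (0 : ℝ) 1) (ht : t ∈ Icc (0 : ℝ) 1) :
    -(d ^ 2 / 8) + d * (t * d + s * d) / 16 + (s * d - t * d) ^ 2 / 128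
      ≤ -(7 / 64 * (1 - (s + t) / 2)) * d ^ 2 := by
  nlinarith [mul_le_mul_of_nonneg_right (sq_sub_le_two_sub_add hs ht) (sq_nonneg d)]

theorem abs_one_sub_slope_correction_le (hs : s ∈ Icc (0 : ℝ) 1) (ht : t ∈ Icc (0 : ℝ) 1)
    (hκ : κ ≤ 1 / 200) (hp₀ : |p₀| ≤ κ) (hp₁ : |p₁| ≤ κ) :
    |1 - (p₁ * s - p₀ * t) / 2| ≤ 201 / 200 := by
  have hρ := abs_le.1 (abs_slope_correction_le hs ht hp₀ hp₁)
  exact abs_le.2 ⟨by linarith, by linarith⟩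

theorem flux_part_le {P : ℝ} (hs : s ∈ Icc (0 : ℝ) 1) (ht : t ∈ Icc (0 : ℝ) 1)
    (hκ : κ ≤ 1 / 200) (hp₀ : |p₀| ≤ κ) (hp₁ : |p₁| ≤ κ) (hP : |P| ≤ κ)
    (hP₀ : |P - p₀| ≤ 5 / 4 * |p₁ - p₀|) (hP₁ : |P - p₁| ≤ 5 / 4 * |p₁ - p₀|) :
    P * ((1 - (p₁ * s - p₀ * t) / 2) * d) * ((s * d - t * d) / 8
        - (p₁ * (s * d) + p₀ * (t * d)) / 4 + P * ((1 - (p₁ * s - p₀ * t) / 2) * d) / 2)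
      ≤ ((1 - (s + t) / 2) / 200 + |p₁ - p₀| / 50) * d ^ 2 := by
  have hw : 0 ≤ 1 - (s + t) / 2 := by linarith [hs.2, ht.2]
  have product_le := abs_mul_le_mul
    (abs_mul_le_mul (hP.trans hκ) (abs_one_sub_slope_correction_le hs ht hκ hp₀ hp₁))
    (abs_flux_factor_le hs ht hκ hp₀ hP hP₀ hP₁)
  calc _ = P * (1 - (p₁ * s - p₀ * t) / 2) * ((s - t) / 8 - (p₁ * s + p₀ * t) / 4
            + P * (1 - (p₁ * s - p₀ * t) / 2) / 2) * d ^ 2 := by ring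
    _ ≤ _ := by
      gcongr
      linarith [(abs_le.1 product_le).2, abs_nonneg (p₁ - p₀)]

/-- The viscosity contributes `-4 * |p₁ - p₀| * d ^ 2`, which beats all the terms produced by the
variation of `p`, and the quadratic part beats those produced by the size of `p`. -/
theorem energy_production_le {P tr : ℝ} (hs : s ∈ Icc (0 : ℝ) 1) (ht : t ∈ Icc (0 : ℝ) 1)
    (hκ : κ ≤ 1 / 200) (hp₀ : |p₀| ≤ κ) (hp₁ : |p₁| ≤ κ) (hP : |P| ≤ κ)
    (hP₀ : |P - p₀| ≤ 5 / 4 * |p₁ - p₀|) (hP₁ : |P - p₁| ≤ 5 / 4 * |p₁ - p₀|)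
    (hmono : 0 ≤ (p₁ - p₀) * d)
    (htr : |tr| ≤ 3 / 2 * |p₁ - p₀| * ((1 - (p₁ * s - p₀ * t) / 2) * d) ^ 2) :
    -(d ^ 2 / 8) + d * (t * d + s * d) / 16 + (s * d - t * d) ^ 2 / 128
        + P * ((1 - (p₁ * s - p₀ * t) / 2) * d) * ((s * d - t * d) / 8
          - (p₁ * (s * d) + p₀ * (t * d)) / 4 + P * ((1 - (p₁ * s - p₀ * t) / 2) * d) / 2)
        + tr - 4 * (p₁ * (s * d * |s * d|) - p₀ * (t * d * |t * d|))
      ≤ -(1 / 50) * (d ^ 2 - (s * d + t * d) * d / 2) := by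
  have hw : 0 ≤ 1 - (s + t) / 2 := by linarith [hs.2, ht.2]
  have trapezoid_part : tr ≤ 2 * |p₁ - p₀| * d ^ 2 := by
    have square_le : (1 - (p₁ * s - p₀ * t) / 2) ^ 2 ≤ 4 / 3 := by
      rw [← sq_abs]
      refine (pow_le_pow_left₀ (abs_nonneg _)
        (abs_one_sub_slope_correction_le hs ht hκ hp₀ hp₁) 2).trans (by norm_num)
    calc tr ≤ 3 / 2 * |p₁ - p₀| * ((1 - (p₁ * s - p₀ * t) / 2) ^ 2 * d ^ 2) := by
          rw [← mul_pow]; exact (le_abs_self tr).trans htr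
      _ ≤ 3 / 2 * |p₁ - p₀| * (4 / 3 * d ^ 2) := by gcongr
      _ = 2 * |p₁ - p₀| * d ^ 2 := by ring
  have coefficient_le : -(7 / 64 * (1 - (s + t) / 2))
      + ((1 - (s + t) / 2) / 200 + |p₁ - p₀| / 50) + 2 * |p₁ - p₀|
      - 4 * (|p₁ - p₀| - 4 * κ * (1 - (s + t) / 2)) ≤ -(1 / 50) * (1 - (s + t) / 2) := by
    linarith [mul_le_mul_of_nonneg_right hκ hw, abs_nonneg (p₁ - p₀)]
  linarith [mul_le_mul_of_nonneg_right coefficient_le (sq_nonneg d),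
    quadratic_part_le (d := d) hs ht, sub_le_viscosity hs ht hp₀ hp₁ hmono,
    flux_part_le (d := d) hs ht hκ hp₀ hp₁ hP hP₀ hP₁]

variable {h p : ℝ → ℝ} {a b : ℝ} {z z₀ z₁ : ℝ × ℝ}

namespace IsCFLFlux

theorem abs_midVal_slope_sub_le (H : IsCFLFlux h p a b κ) {v : ℝ} (hz : z ∈ nodeStates a b)
    (hv : v ∈ Icc a b) (hσ : |z.2| ≤ |v - z.1|) :
    |p (midVal p z) - p z.1| ≤ |p v - p z.1| / 4 := by
  have hu := fst_mem_Icc_of_mem_nodeStates hz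
  refine H.slow_variation _ hu v hv _ (H.midVal_mem hz) ((H.abs_midVal_sub_le hu).trans ?_)
  gcongr
  linarith [H.abs_deriv_le _ hu, abs_nonneg (p z.1)]

theorem exists_secant_slope_midVal (H : IsCFLFlux h p a b κ) (hz₀ : z₀ ∈ nodeStates a b)
    (hz₁ : z₁ ∈ nodeStates a b) (hσ₀ : |z₀.2| ≤ |z₁.1 - z₀.1|) (hσ₁ : |z₁.2| ≤ |z₁.1 - z₀.1|) :
    |p (midVal p z₁) - p (midVal p z₀)| ≤ 3 / 2 * |p z₁.1 - p z₀.1| ∧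
      ∃ P, h (midVal p z₁) - h (midVal p z₀) = P * (midVal p z₁ - midVal p z₀) ∧ |P| ≤ κ ∧
        |P - p z₀.1| ≤ 5 / 4 * |p z₁.1 - p z₀.1| ∧ |P - p z₁.1| ≤ 5 / 4 * |p z₁.1 - p z₀.1| := by
  have close₀ := H.abs_midVal_slope_sub_le hz₀ (fst_mem_Icc_of_mem_nodeStates hz₁) hσ₀
  have close₁ := H.abs_midVal_slope_sub_le hz₁ (fst_mem_Icc_of_mem_nodeStates hz₀)
    (by rwa [abs_sub_comm z₀.1])
  rw [abs_sub_comm (p z₀.1)] at close₁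
  have gap := le_abs_self (p z₁.1 - p z₀.1)
  have gap' := neg_abs_le (p z₁.1 - p z₀.1)
  obtain ⟨P, hP, heq⟩ :=
    H.isSubgradientOn.exists_secant_slope (H.midVal_mem hz₀) (H.midVal_mem hz₁)
  have hP_le : |P| ≤ κ := abs_le.2 <| uIcc_subset_Icc
    (abs_le.1 (H.abs_deriv_le _ (H.midVal_mem hz₀)))
    (abs_le.1 (H.abs_deriv_le _ (H.midVal_mem hz₁))) hP
  rw [abs_le] at close₀ close₁
  refine ⟨abs_le.2 ⟨by linarith, by linarith⟩, P, heq, hP_le, ?_⟩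
  rcases mem_uIcc.1 hP with ⟨hl, hr⟩ | ⟨hl, hr⟩ <;>
    exact ⟨abs_le.2 ⟨by linarith, by linarith⟩, abs_le.2 ⟨by linarith, by linarith⟩⟩

theorem entropyFlux_sub (H : IsCFLFlux h p a b κ) (hz₀ : z₀ ∈ nodeStates a b)
    (hz₁ : z₁ ∈ nodeStates a b) :
    (z₀.1 + numFlux h p z₁ - numFlux h p z₀) ^ 2 / 2 - (z₀.1 ^ 2 + z₁.1 ^ 2) / 4
        + entropyFlux h p a z₁ - entropyFlux h p a z₀
      = -((z₁.1 - z₀.1) ^ 2 / 8) + (z₁.1 - z₀.1) * (z₀.2 + z₁.2) / 16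
        + (z₁.2 - z₀.2) ^ 2 / 128
        + (h (midVal p z₁) - h (midVal p z₀)) * ((z₁.2 - z₀.2) / 8
          - (p z₁.1 * z₁.2 + p z₀.1 * z₀.2) / 4 + (h (midVal p z₁) - h (midVal p z₀)) / 2)
        + ((midVal p z₁ - midVal p z₀) * ((h (midVal p z₀) + h (midVal p z₁)) / 2)
          - ∫ u in midVal p z₀..midVal p z₁, h u)
        - 4 * (p z₁.1 * (z₁.2 * |z₁.2|) - p z₀.1 * (z₀.2 * |z₀.2|)) := by
  have integrable {m : ℝ} (hm : m ∈ Icc a b) : IntervalIntegrable h volume a m :=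
    (H.continuousOn.mono (Icc_subset_Icc_right hm.2)).intervalIntegrable_of_Icc hm.1
  rw [← intervalIntegral.integral_interval_sub_left (integrable (H.midVal_mem hz₁))
    (integrable (H.midVal_mem hz₀))]
  have identity := energy_identity (h₀ := h (midVal p z₀)) (h₁ := h (midVal p z₁))
    (I₀ := ∫ u in a..midVal p z₀, h u) (I₁ := ∫ u in a..midVal p z₁, h u)
    (rfl : midVal p z₀ = z₀.1 - p z₀.1 / 2 * z₀.2) (rfl : midVal p z₁ = z₁.1 - p z₁.1 / 2 * z₁.2)
  simp only [numFlux, entropyFlux]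
  linarith

theorem cell_energy_le (H : IsCFLFlux h p a b κ) (hz₀ : z₀ ∈ nodeStates a b)
    (hz₁ : z₁ ∈ nodeStates a b) (ht : t ∈ Icc (0 : ℝ) 1) (hs : s ∈ Icc (0 : ℝ) 1)
    (hσ₀ : z₀.2 = t * (z₁.1 - z₀.1)) (hσ₁ : z₁.2 = s * (z₁.1 - z₀.1)) :
    (z₀.1 + numFlux h p z₁ - numFlux h p z₀) ^ 2 / 2 - (z₀.1 ^ 2 + z₁.1 ^ 2) / 4
        + entropyFlux h p a z₁ - entropyFlux h p a z₀
      ≤ -(1 / 50) * ((z₁.1 - z₀.1) ^ 2 - (z₁.2 + z₀.2) * (z₁.1 - z₀.1) / 2) := by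
  rw [H.entropyFlux_sub hz₀ hz₁]
  have hu₀ := fst_mem_Icc_of_mem_nodeStates hz₀
  have hu₁ := fst_mem_Icc_of_mem_nodeStates hz₁
  have abs_slope_le {σ r : ℝ} (hr : r ∈ Icc (0 : ℝ) 1) (hσ : σ = r * (z₁.1 - z₀.1)) :
      |σ| ≤ |z₁.1 - z₀.1| := by
    rw [hσ, abs_mul, abs_of_nonneg hr.1]
    exact mul_le_of_le_one_left (abs_nonneg _) hr.2
  obtain ⟨hq, P, hP, hPκ, hP₀, hP₁⟩ :=
    H.exists_secant_slope_midVal hz₀ hz₁ (abs_slope_le ht hσ₀) (abs_slope_le hs hσ₁)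
  have trapezoid := (H.isSubgradientOn.abs_trapezoid_sub_integral_le H.continuousOn
    (H.midVal_mem hz₀) (H.midVal_mem hz₁)).trans (mul_le_mul_of_nonneg_right hq (sq_nonneg _))
  have hmono : 0 ≤ (p z₁.1 - p z₀.1) * (z₁.1 - z₀.1) := by
    nlinarith [H.isSubgradientOn _ hu₀ _ hu₁, H.isSubgradientOn _ hu₁ _ hu₀]
  have midVal_sub : midVal p z₁ - midVal p z₀
      = (1 - (p z₁.1 * s - p z₀.1 * t) / 2) * (z₁.1 - z₀.1) := by
    rw [midVal, midVal, hσ₀, hσ₁]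
    ring
  rw [midVal_sub] at trapezoid hP ⊢
  rw [hP, hσ₀, hσ₁]
  exact energy_production_le hs ht H.kappa_le (H.abs_deriv_le _ hu₀) (H.abs_deriv_le _ hu₁)
    hPκ hP₀ hP₁ hmono trapezoid

end IsCFLFlux

theorem abs_snd_le_fst_sub (hz : z ∈ nodeStates a b) : |z.2| ≤ z.1 - a :=
  abs_le.2 ⟨by linarith [hz.2.1], by linarith [hz.1.1]⟩

theorem abs_snd_le_sub_fst (hz : z ∈ nodeStates a b) : |z.2| ≤ b - z.1 :=
  abs_le.2 ⟨by linarith [hz.1.2], by linarith [hz.2.2]⟩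

theorem IsCFLFlux.abs_snd_add_abs_sub_le (H : IsCFLFlux h p a b κ) (hz : z ∈ nodeStates a b)
    {e : ℝ} (he : e ∈ Icc a b) (hσ : |z.2| ≤ |z.1 - e|) :
    |z.2| / 8 + |h (midVal p z) - h e| ≤ |z.1 - e| / 2 := by
  have hu := fst_mem_Icc_of_mem_nodeStates hz
  have hκ : 0 ≤ κ := (abs_nonneg _).trans (H.abs_deriv_le _ hu)
  have flux_le := H.isSubgradientOn.abs_sub_le H.abs_deriv_le he (H.midVal_mem hz)
  have midVal_sub_le : |midVal p z - e| ≤ 2 * |z.1 - e| := by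
    have hmid := H.abs_midVal_sub_le hu
    nlinarith [abs_sub_le (midVal p z) z.1 e, H.kappa_le, abs_nonneg z.2]
  nlinarith [H.kappa_le, abs_nonneg (z.1 - e)]

/-- All fluxes of the scheme agree at the two endpoints, so that both are stationary states to which
the new value can be compared. -/
theorem add_numFlux_sub_mem_Icc {h₀ p₀ h₁ p₁ : ℝ → ℝ} (H₀ : IsCFLFlux h₀ p₀ a b κ)
    (H₁ : IsCFLFlux h₁ p₁ a b κ) (ha : h₀ a = h₁ a) (hb : h₀ b = h₁ b)
    (hz₀ : z₀ ∈ nodeStates a b) (hz₁ : z₁ ∈ nodeStates a b) :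
    z₀.1 + numFlux h₁ p₁ z₁ - numFlux h₀ p₀ z₀ ∈ Icc a b := by
  have hab : a ≤ b := hz₀.1.1.trans hz₀.1.2
  have bounds {h p : ℝ → ℝ} {z : ℝ × ℝ} (H : IsCFLFlux h p a b κ) (hz : z ∈ nodeStates a b) :
      |z.2| / 8 + |h (midVal p z) - h a| ≤ (z.1 - a) / 2 ∧
        |z.2| / 8 + |h (midVal p z) - h b| ≤ (b - z.1) / 2 := by
    have hσa := abs_snd_le_fst_sub hz
    have hσb := abs_snd_le_sub_fst hz
    have hza := abs_of_nonneg ((abs_nonneg _).trans hσa)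
    have hzb := abs_of_nonneg ((abs_nonneg _).trans hσb)
    constructor
    · rw [← hza]
      exact H.abs_snd_add_abs_sub_le hz (left_mem_Icc.2 hab) (hza.symm ▸ hσa)
    · rw [← hzb, abs_sub_comm b]
      exact H.abs_snd_add_abs_sub_le hz (right_mem_Icc.2 hab)
        (by rwa [abs_sub_comm z.1, hzb])
  obtain ⟨lower₀, upper₀⟩ := bounds H₀ hz₀
  obtain ⟨lower₁, upper₁⟩ := bounds H₁ hz₁
  rw [← ha] at lower₁
  rw [← hb] at upper₁
  rw [numFlux, numFlux]
  constructor
  · linarith [le_abs_self (h₁ (midVal p₁ z₁) - h₀ a), neg_abs_le (h₀ (midVal p₀ z₀) - h₀ a),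
      le_abs_self z₁.2, neg_abs_le z₀.2]
  · linarith [neg_abs_le (h₁ (midVal p₁ z₁) - h₀ b), le_abs_self (h₀ (midVal p₀ z₀) - h₀ b),
      neg_abs_le z₁.2, le_abs_self z₀.2]

end CellEnergy

section FluxFamily

variable {X : Type*} [PseudoMetricSpace X] {h p : X → ℝ → ℝ} {K : Set X} {a b κ : ℝ}

/-- Scaled fluxes `h x = λ f(x, ·)` with `p x = λ f_u(x, ·)` for coefficients `x ∈ K`, satisfying a
common CFL condition, depending on `x` in a Lipschitz way, and independent of `x` at the endpoints
of `[a, b]`. -/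
structure IsCFLFluxFamily (h p : X → ℝ → ℝ) (K : Set X) (a b κ : ℝ) : Prop where
  isCFLFlux : ∀ x ∈ K, IsCFLFlux (h x) (p x) a b κ
  boundedLipschitzOn_flux : BoundedLipschitzOn h K (Icc a b)
  boundedLipschitzOn_deriv : BoundedLipschitzOn p K (Icc a b)
  eq_left : ∀ x ∈ K, ∀ y ∈ K, h x a = h y a
  eq_right : ∀ x ∈ K, ∀ y ∈ K, h x b = h y b

theorem abs_fst_le_of_mem_nodeStates {z : ℝ × ℝ} (hz : z ∈ nodeStates a b) :
    |z.1| ≤ max |a| |b| :=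
  abs_le_max_abs_abs (fst_mem_Icc_of_mem_nodeStates hz).1 (fst_mem_Icc_of_mem_nodeStates hz).2

theorem boundedLipschitzOn_fst : BoundedLipschitzOn (fun (_ : X) z => z.1) K (nodeStates a b) :=
  .of_abs_le fun _ hz => abs_fst_le_of_mem_nodeStates hz

theorem abs_snd_le_of_mem_nodeStates {z : ℝ × ℝ} (hz : z ∈ nodeStates a b) : |z.2| ≤ b - a := by
  linarith [abs_snd_le_fst_sub hz, (fst_mem_Icc_of_mem_nodeStates hz).2]

theorem boundedLipschitzOn_snd : BoundedLipschitzOn (fun (_ : X) z => z.2) K (nodeStates a b) :=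
  .of_abs_le fun _ hz => abs_snd_le_of_mem_nodeStates hz

namespace IsCFLFluxFamily

theorem boundedLipschitzOn_midVal (H : IsCFLFluxFamily h p K a b κ) :
    BoundedLipschitzOn (fun x => midVal (p x)) K (nodeStates a b) :=
  (boundedLipschitzOn_fst.sub ((((H.boundedLipschitzOn_deriv.comp_right fun _ hz =>
    fst_mem_Icc_of_mem_nodeStates hz).const_mul (1 / 2)).mul boundedLipschitzOn_snd))).congr
    fun x _ z _ => by rw [midVal]; ring

theorem boundedLipschitzOn_flux_midVal (H : IsCFLFluxFamily h p K a b κ) :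
    BoundedLipschitzOn (fun x z => h x (midVal (p x) z)) K (nodeStates a b) :=
  H.boundedLipschitzOn_flux.comp_of_lipschitz H.boundedLipschitzOn_midVal
    (fun x hx _ hz => (H.isCFLFlux x hx).midVal_mem hz) fun x hx _ hu _ hv =>
      (H.isCFLFlux x hx).isSubgradientOn.abs_sub_le (H.isCFLFlux x hx).abs_deriv_le hv hu

theorem boundedLipschitzOn_numFlux (H : IsCFLFluxFamily h p K a b κ) :
    BoundedLipschitzOn (fun x => numFlux (h x) (p x)) K (nodeStates a b) :=
  (((boundedLipschitzOn_fst.const_mul (1 / 2)).sub (boundedLipschitzOn_snd.const_mul (1 / 8))).sub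
    H.boundedLipschitzOn_flux_midVal).congr fun x _ z _ => by rw [numFlux]; ring

theorem boundedLipschitzOn_integral_midVal (H : IsCFLFluxFamily h p K a b κ) :
    BoundedLipschitzOn (fun x z => ∫ u in a..midVal (p x) z, h x u) K (nodeStates a b) := by
  have hcont (x : X) (hx : x ∈ K) := (H.isCFLFlux x hx).continuousOn
  obtain ⟨C, -, hC⟩ := H.boundedLipschitzOn_flux
  refine (H.boundedLipschitzOn_flux.integral hcont).comp_of_lipschitz (L := C)
    H.boundedLipschitzOn_midVal (fun x hx _ hz => (H.isCFLFlux x hx).midVal_mem hz)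
    fun x hx u hu v hv => ?_
  have integrable {y : ℝ} (hy : y ∈ Icc a b) : IntervalIntegrable (h x) volume a y :=
    ((hcont x hx).mono (Icc_subset_Icc_right hy.2)).intervalIntegrable_of_Icc hy.1
  rw [intervalIntegral.integral_interval_sub_left (integrable hu) (integrable hv)]
  refine intervalIntegral.norm_integral_le_of_norm_le_const (E := ℝ) fun w hw => ?_
  exact (hC w (uIcc_subset_Icc hv hu (uIoc_subset_uIcc hw)) x hx).1

theorem boundedLipschitzOn_entropyFlux (H : IsCFLFluxFamily h p K a b κ) :
    BoundedLipschitzOn (fun x => entropyFlux (h x) (p x) a) K (nodeStates a b) := by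
  have deriv_fst : BoundedLipschitzOn (fun x z => p x z.1) K (nodeStates a b) :=
    H.boundedLipschitzOn_deriv.comp_right fun _ hz => fst_mem_Icc_of_mem_nodeStates hz
  have abs_snd : BoundedLipschitzOn (fun (_ : X) z => |z.2|) K (nodeStates a b) :=
    .of_abs_le fun _ hz => (abs_abs _).trans_le (abs_snd_le_of_mem_nodeStates hz)
  exact ((((boundedLipschitzOn_fst.mul boundedLipschitzOn_snd).const_mul (1 / 8)).add
    ((H.boundedLipschitzOn_midVal.mul H.boundedLipschitzOn_flux_midVal).sub
      H.boundedLipschitzOn_integral_midVal)).sub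
    ((deriv_fst.mul (boundedLipschitzOn_snd.mul abs_snd)).const_mul 4)).congr
    fun x _ z _ => by rw [entropyFlux]; ring

/-- Changing the coefficient at the right node to the one at the left node costs at most
`Λ * dist x₁ x₀`. -/
theorem exists_cell_energy_le (H : IsCFLFluxFamily h p K a b κ) :
    ∃ Λ, 0 ≤ Λ ∧ ∀ x₀ ∈ K, ∀ x₁ ∈ K, ∀ z₀ ∈ nodeStates a b, ∀ z₁ ∈ nodeStates a b,
      ∀ t ∈ Icc (0 : ℝ) 1, ∀ s ∈ Icc (0 : ℝ) 1,
        z₀.2 = t * (z₁.1 - z₀.1) → z₁.2 = s * (z₁.1 - z₀.1) →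
          (z₀.1 + numFlux (h x₁) (p x₁) z₁ - numFlux (h x₀) (p x₀) z₀) ^ 2 / 2
              - (z₀.1 ^ 2 + z₁.1 ^ 2) / 4
              + entropyFlux (h x₁) (p x₁) a z₁ - entropyFlux (h x₀) (p x₀) a z₀
            ≤ -(1 / 50) * ((z₁.1 - z₀.1) ^ 2 - (z₁.2 + z₀.2) * (z₁.1 - z₀.1) / 2)
              + Λ * dist x₁ x₀ := by
  let data : Set (X × (ℝ × ℝ) × (ℝ × ℝ)) := K ×ˢ nodeStates a b ×ˢ nodeStates a b
  obtain ⟨B, -, hB⟩ := H.boundedLipschitzOn_numFlux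
  have left_flux : BoundedLipschitzOn (fun (_ : X) w => numFlux (h w.1) (p w.1) w.2.1) K data :=
    .of_abs_le fun w hw => (hB w.2.1 hw.2.1 w.1 hw.1).1
  have left_value : BoundedLipschitzOn (fun (_ : X) w => w.2.1.1) K data :=
    boundedLipschitzOn_fst.comp_right fun w hw => hw.2.1
  have right_flux : BoundedLipschitzOn (fun x w => numFlux (h x) (p x) w.2.2) K data :=
    H.boundedLipschitzOn_numFlux.comp_right fun w hw => hw.2.2
  have right_entropyFlux : BoundedLipschitzOn (fun x w => entropyFlux (h x) (p x) a w.2.2) K data :=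
    H.boundedLipschitzOn_entropyFlux.comp_right fun w hw => hw.2.2
  have new_value := (left_value.add right_flux).sub left_flux
  obtain ⟨Λ, hΛ, hLip⟩ := ((new_value.mul new_value).const_mul (1 / 2)).add right_entropyFlux
  refine ⟨Λ, hΛ, fun x₀ hx₀ x₁ hx₁ z₀ hz₀ z₁ hz₁ t ht s hs hσ₀ hσ₁ => ?_⟩
  have perturbation := (hLip (x₀, z₀, z₁) ⟨hx₀, hz₀, hz₁⟩ x₁ hx₁).2 x₀ hx₀
  dsimp only at perturbation
  linarith [(abs_le.1 perturbation).2, (H.isCFLFlux x₀ hx₀).cell_energy_le hz₀ hz₁ ht hs hσ₀ hσ₁]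

end IsCFLFluxFamily

end FluxFamily

section Slopes

variable {v : ℤ → ℝ} {j : ℤ}

theorem exists_sign_mul_eq_mul {x m : ℝ} (hm₀ : 0 ≤ m) (hm : m ≤ |x|) :
    ∃ τ ∈ Icc (0 : ℝ) 1, Real.sign x * m = τ * x := by
  refine ⟨m / |x|, ⟨by positivity, div_le_one_of_le₀ hm (abs_nonneg x)⟩, ?_⟩
  rcases lt_trichotomy x 0 with hx | rfl | hx
  · rw [Real.sign_of_neg hx, abs_of_neg hx, div_neg, neg_mul, neg_mul, one_mul,
      div_mul_cancel₀ _ hx.ne]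
  · simp
  · rw [Real.sign_of_pos hx, abs_of_pos hx, div_mul_cancel₀ _ hx.ne', one_mul]

theorem exists_minmod_eq_mul (a b c : ℝ) :
    (∃ τ ∈ Icc (0 : ℝ) 1, minmod a b c = τ * a) ∧ ∃ τ ∈ Icc (0 : ℝ) 1, minmod a b c = τ * c := by
  rw [minmod]
  split_ifs with hsign
  · have nonneg : 0 ≤ min |a| (min |b| |c|) := by positivity
    refine ⟨exists_sign_mul_eq_mul nonneg (min_le_left _ _), ?_⟩
    rw [hsign.1, hsign.2]
    exact exists_sign_mul_eq_mul nonneg ((min_le_right _ _).trans (min_le_right _ _))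
  · exact ⟨⟨0, by simp, by simp⟩, ⟨0, by simp, by simp⟩⟩

theorem exists_slope_eq_mul_diff (v : ℤ → ℝ) (j : ℤ) :
    ∃ τ ∈ Icc (0 : ℝ) 1, slope v j = τ * diff v j :=
  (exists_minmod_eq_mul _ _ _).1

theorem exists_slope_succ_eq_mul_diff (v : ℤ → ℝ) (j : ℤ) :
    ∃ τ ∈ Icc (0 : ℝ) 1, slope v (j + 1) = τ * diff v j := by
  rw [slope, diff, add_sub_cancel_right]
  exact (exists_minmod_eq_mul _ _ _).2

theorem mk_slope_mem_nodeStates {a b : ℝ} (hv : ∀ i, v i ∈ Icc a b) (j : ℤ) :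
    (v j, slope v j) ∈ nodeStates a b := by
  constructor
  · obtain ⟨τ, hτ, h⟩ := exists_slope_succ_eq_mul_diff v (j - 1)
    rw [sub_add_cancel, diff, sub_add_cancel] at h
    convert (convex_Icc a b).add_smul_sub_mem (hv j) (hv (j - 1)) hτ using 1
    rw [h, smul_eq_mul]
    ring
  · obtain ⟨τ, hτ, h⟩ := exists_slope_eq_mul_diff v j
    convert (convex_Icc a b).add_smul_sub_mem (hv j) (hv (j + 1)) hτ using 1
    rw [h, smul_eq_mul, diff]

/-- The part of the squared increment that is not recovered by the slopes. One step of the scheme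
dissipates a multiple of its sum, and it dominates the weighted squared increments. -/
def dissipation (v : ℤ → ℝ) (j : ℤ) : ℝ :=
  diff v j ^ 2 - (slope v (j + 1) + slope v j) * diff v j / 2

theorem bracket_bounds {β s t : ℝ} (hβ : |β| ≤ 1 / 4) (hs : s ∈ Icc (0 : ℝ) 1)
    (ht : t ∈ Icc (0 : ℝ) 1) :
    0 ≤ 1 - 1 / 16 * (1 - 4 * β ^ 2) * (s - t) ^ 2 - β * (s - t) - (s + t) / 2 ∧
      1 - 1 / 16 * (1 - 4 * β ^ 2) * (s - t) ^ 2 - β * (s - t) - (s + t) / 2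
        ≤ 2 * (1 - (s + t) / 2) := by
  have linear_term := abs_le.1 (abs_mul_le_mul hβ (abs_sub_le_two_sub_add hs ht))
  have factor_nonneg : 0 ≤ 1 - 4 * β ^ 2 := by nlinarith [abs_le.1 hβ]
  have square_nonneg : 0 ≤ (1 - 4 * β ^ 2) * (s - t) ^ 2 := by positivity
  have square_le : (1 - 4 * β ^ 2) * (s - t) ^ 2 ≤ 1 * (2 - (s + t)) :=
    mul_le_mul (by linarith [sq_nonneg β]) (sq_sub_le_two_sub_add hs ht) (sq_nonneg _) zero_le_one
  constructor <;> linarith [hs.2, ht.2]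

theorem weight_bounds {f : ℝ → ℝ → ℝ} {uMin uMax lam kMid γ₂ : ℝ} {kk : ℤ → ℝ}
    (hβ : |beta f uMin uMax lam kk v j| ≤ 1 / 4)
    (hnonneg : 0 ≤ fluxUU f uMin uMax kMid ((v j + v (j + 1)) / 2))
    (hle : fluxUU f uMin uMax kMid ((v j + v (j + 1)) / 2) ≤ γ₂) :
    0 ≤ weight f uMin uMax lam kk v kMid j ∧
      weight f uMin uMax lam kk v kMid j * diff v j ^ 2 ≤ γ₂ / 4 * dissipation v j := by
  obtain ⟨t, ht, hσ₀⟩ := exists_slope_eq_mul_diff v j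
  obtain ⟨s, hs, hσ₁⟩ := exists_slope_succ_eq_mul_diff v j
  have diff_slope : diff (slope v) j = (s - t) * diff v j := by
    rw [diff, hσ₀, hσ₁]
    ring
  rw [weight, dissipation, diff_slope, hσ₀, hσ₁]
  generalize beta f uMin uMax lam kk v j = β at *
  generalize fluxUU f uMin uMax kMid ((v j + v (j + 1)) / 2) = F at *
  generalize diff v j = d at *
  have factor_nonneg : 0 ≤ 1 - 4 * β ^ 2 := by nlinarith [abs_le.1 hβ]
  rcases eq_or_ne d 0 with rfl | hd
  · simp only [mul_zero, div_zero, add_zero]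
    norm_num
    positivity
  · rw [mul_div_cancel_right₀ _ hd, ← add_mul, mul_div_mul_right _ _ hd]
    obtain ⟨bracket_nonneg, bracket_le⟩ := bracket_bounds hβ hs ht
    refine ⟨by positivity, ?_⟩
    have factor_le : 1 - 4 * β ^ 2 ≤ 1 := by linarith [sq_nonneg β]
    have gap_nonneg : 0 ≤ 1 - (s + t) / 2 := by linarith [hs.2, ht.2]
    calc _ ≤ 1 / 8 * 1 * (2 * (1 - (s + t) / 2)) * γ₂ * d ^ 2 := by gcongr
      _ = γ₂ / 4 * (d ^ 2 - (s + t) * d * d / 2) := by ring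

end Slopes

section CellAverages

variable {w : ℝ → ℝ} {dx : ℝ}

theorem intervalIntegrable_of_boundedVariationOn (hw : BoundedVariationOn w univ) (a b : ℝ) :
    IntervalIntegrable w volume a b := by
  obtain ⟨p, q, hp, hq, rfl⟩ :=
    hw.locallyBoundedVariationOn.exists_monotoneOn_sub_monotoneOn
  exact (monotoneOn_univ.1 hp).intervalIntegrable.sub (monotoneOn_univ.1 hq).intervalIntegrable

theorem HasBV.intervalIntegrable (hw : HasBV w) (a b : ℝ) : IntervalIntegrable w volume a b := by
  obtain ⟨v, hwv, hv⟩ := hw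
  exact (intervalIntegrable_of_boundedVariationOn hv a b).congr_ae (ae_restrict_of_ae hwv.symm)

theorem cellAvg_eq_average (w : ℝ → ℝ) (dx p : ℝ) :
    cellAvg w dx p = ⨍ x in ((p - 1 / 2) * dx)..((p + 1 / 2) * dx), w x := by
  rw [interval_average_eq, cellAvg, smul_eq_mul, one_div]
  congr 2
  ring

theorem cellAvg_mem {s : Set ℝ} (hw : HasBV w) (hs : Convex ℝ s) (hclosed : IsClosed s)
    (hmem : ∀ᵐ x, w x ∈ s) (hdx : 0 < dx) (p : ℝ) : cellAvg w dx p ∈ s := by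
  have hlt : (p - 1 / 2) * dx < (p + 1 / 2) * dx := by gcongr; linarith
  rw [cellAvg_eq_average, uIoc_of_le hlt.le]
  refine hs.set_average_mem hclosed ?_ ?_ (ae_restrict_of_ae hmem)
    ((intervalIntegrable_iff_integrableOn_Ioc_of_le hlt.le).1 (hw.intervalIntegrable _ _))
  · simpa using hlt
  · exact measure_Ioc_lt_top.ne

theorem cellAvg_congr {v : ℝ → ℝ} (h : w =ᵐ[volume] v) (dx p : ℝ) :
    cellAvg w dx p = cellAvg v dx p := by
  rw [cellAvg, cellAvg, intervalIntegral.integral_congr_ae (h.mono fun _ hx _ => hx)]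

theorem cellAvg_eq_integral_comp (hdx : 0 < dx) (p : ℝ) :
    cellAvg w dx p = ∫ y in (-(1 / 2) : ℝ)..1 / 2, w ((p + y) * dx) := by
  have subst := intervalIntegral.integral_comp_add_mul w hdx.ne' (p * dx)
    (a := -(1 / 2)) (b := 1 / 2)
  simp only [cellAvg, add_mul, sub_mul, one_div, mul_comm dx] at subst ⊢
  rw [subst, smul_eq_mul]
  congr 2
  ring

theorem sum_abs_sub_le_variation (hw : BoundedVariationOn w univ) {x : ℕ → ℝ} (hx : Monotone x)
    (M : ℕ) : ∑ i ∈ Finset.range M, |w (x (i + 1)) - w (x i)| ≤ (eVariationOn w univ).toReal := by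
  have hle := eVariationOn.sum_le (f := w) (n := M) hx fun i => mem_univ (x i)
  rw [← ENNReal.ofReal_le_iff_le_toReal hw, ENNReal.ofReal_sum_of_nonneg fun _ _ => abs_nonneg _]
  simpa only [edist_dist, Real.dist_eq] using hle

/-- The averages along a grid are means over `y` of the values along the grid shifted by `y`. -/
theorem sum_abs_cellAvg_sub_le (hw : BoundedVariationOn w univ) (hdx : 0 < dx) (p : ℝ) (M : ℕ) :
    ∑ i ∈ Finset.range M, |cellAvg w dx (p + (i + 1)) - cellAvg w dx (p + i)|
      ≤ (eVariationOn w univ).toReal := by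
  have integrable (q : ℝ) :
      IntervalIntegrable (fun y => w ((q + y) * dx)) volume (-(1 / 2)) (1 / 2) := by
    refine intervalIntegrable_of_boundedVariationOn (ne_top_of_le_ne_top hw ?_) _ _
    refine eVariationOn.comp_le_of_monotoneOn w _ ?_ (mapsTo_univ _ _)
    exact Monotone.monotoneOn (fun y z hyz => by gcongr) _
  have abs_integrable (i : ℕ) (_ : i ∈ Finset.range M) : IntervalIntegrable
      (fun y => |w ((p + (i + 1) + y) * dx) - w ((p + i + y) * dx)|) volume (-(1 / 2)) (1 / 2) :=
    ((integrable _).sub (integrable _)).abs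
  have half : (-(1 / 2) : ℝ) ≤ 1 / 2 := by norm_num
  calc ∑ i ∈ Finset.range M, |cellAvg w dx (p + (i + 1)) - cellAvg w dx (p + i)|
      ≤ ∑ i ∈ Finset.range M, ∫ y in (-(1 / 2) : ℝ)..1 / 2,
          |w ((p + (i + 1) + y) * dx) - w ((p + i + y) * dx)| := by
        gcongr with i
        rw [cellAvg_eq_integral_comp hdx, cellAvg_eq_integral_comp hdx,
          ← intervalIntegral.integral_sub (integrable _) (integrable _)]
        exact intervalIntegral.abs_integral_le_integral_abs half
    _ = ∫ y in (-(1 / 2) : ℝ)..1 / 2, ∑ i ∈ Finset.range M,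
          |w ((p + (i + 1) + y) * dx) - w ((p + i + y) * dx)| :=
        (intervalIntegral.integral_finsetSum abs_integrable).symm
    _ ≤ ∫ _ in (-(1 / 2) : ℝ)..1 / 2, (eVariationOn w univ).toReal := by
        refine intervalIntegral.integral_mono_on half
          (by simpa only [Finset.sum_fn] using IntervalIntegrable.sum _ abs_integrable)
          intervalIntegrable_const fun y _ => ?_
        have grid_monotone : Monotone fun i : ℕ => (p + i + y) * dx := fun i i' hi => by
          dsimp only
          gcongr
        simpa using sum_abs_sub_le_variation hw grid_monotone M
    _ = (eVariationOn w univ).toReal := by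
        rw [intervalIntegral.integral_const, smul_eq_mul]
        ring

theorem HasBV.exists_sum_abs_cellAvg_sub_le (hw : HasBV w) :
    ∃ R, ∀ dx, 0 < dx → ∀ (p : ℝ) (M : ℕ),
      ∑ i ∈ Finset.range M, |cellAvg w dx (p + (i + 1)) - cellAvg w dx (p + i)| ≤ R := by
  obtain ⟨v, hwv, hv⟩ := hw
  refine ⟨(eVariationOn v univ).toReal, fun dx hdx p M => ?_⟩
  simp only [cellAvg_congr hwv]
  exact sum_abs_cellAvg_sub_le hv hdx p M

end CellAverages

section Summation

theorem abs_sum_mul_sub_le {a y : ℕ → ℝ} {C B R : ℝ} {M : ℕ} (ha : ∀ i, |a i| ≤ C)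
    (hy : ∀ i, |y i| ≤ B) (hR : ∑ i ∈ Finset.range M, |a (i + 1) - a i| ≤ R) :
    |∑ i ∈ Finset.range M, a i * (y (i + 1) - y i)| ≤ (2 * C + R) * B := by
  have hB : 0 ≤ B := (abs_nonneg _).trans (hy 0)
  have by_parts : ∑ i ∈ Finset.range M, a i * (y (i + 1) - y i)
      = (a M * y M - a 0 * y 0) - ∑ i ∈ Finset.range M, (a (i + 1) - a i) * y (i + 1) := by
    rw [← Finset.sum_range_sub (fun i => a i * y i), ← Finset.sum_sub_distrib]
    exact Finset.sum_congr rfl fun i _ => by ring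
  have variation_term : |∑ i ∈ Finset.range M, (a (i + 1) - a i) * y (i + 1)| ≤ R * B :=
    calc |∑ i ∈ Finset.range M, (a (i + 1) - a i) * y (i + 1)|
        ≤ ∑ i ∈ Finset.range M, |a (i + 1) - a i| * B :=
          (Finset.abs_sum_le_sum_abs _ _).trans
            (Finset.sum_le_sum fun i _ => abs_mul_le_mul le_rfl (hy _))
      _ ≤ R * B := by rw [← Finset.sum_mul]; gcongr
  have boundary_term (i : ℕ) : |a i * y i| ≤ C * B := abs_mul_le_mul (ha i) (hy i)
  rw [by_parts]
  linarith [abs_sub (a M * y M - a 0 * y 0)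
      (∑ i ∈ Finset.range M, (a (i + 1) - a i) * y (i + 1)),
    abs_sub (a M * y M) (a 0 * y 0), boundary_term M, boundary_term 0]

theorem sum_dissipation_le_energy_sub {U V D Q r : ℕ → ℝ} {C B : ℝ} (M : ℕ)
    (hcell : ∀ i, V i ^ 2 / 2 - (U i ^ 2 + U (i + 1) ^ 2) / 4 + Q (i + 1) - Q i ≤ -D i + r i)
    (hU : ∀ i, |U i| ≤ C) (hQ : ∀ i, |Q i| ≤ B) :
    ∑ i ∈ Finset.range M, D i
      ≤ ∑ i ∈ Finset.range M, U i ^ 2 / 2 - ∑ i ∈ Finset.range M, V i ^ 2 / 2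
        + (C ^ 2 / 4 + 2 * B + ∑ i ∈ Finset.range M, r i) := by
  have telescope := Finset.sum_range_sub (fun i => U i ^ 2 / 4 - Q i) M
  have hsum : ∑ i ∈ Finset.range M, D i ≤ ∑ i ∈ Finset.range M,
      (U i ^ 2 / 2 - V i ^ 2 / 2 + (U (i + 1) ^ 2 / 4 - Q (i + 1) - (U i ^ 2 / 4 - Q i)) + r i) :=
    Finset.sum_le_sum fun i _ => by linarith [hcell i]
  rw [Finset.sum_add_distrib, Finset.sum_add_distrib, telescope, Finset.sum_sub_distrib] at hsum
  linarith [sq_le_sq' (abs_le.1 (hU M)).1 (abs_le.1 (hU M)).2, sq_nonneg (U 0),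
    (abs_le.1 (hQ M)).1, (abs_le.1 (hQ 0)).2]

/-- The initial energy need not be finite on the whole line; its drop is instead controlled by
convexity, `U₀² / 2 - U_N² / 2 ≤ U₀ (U₀ - U_N)`, and summation by parts. -/
theorem energy_sub_le {U Y : ℕ → ℕ → ℝ} {C B R : ℝ} {M : ℕ}
    (hcons : ∀ n i, U (n + 1) i - U n i = Y n (i + 1) - Y n i) (hU : ∀ i, |U 0 i| ≤ C)
    (hY : ∀ n i, |Y n i| ≤ B) (hR : ∑ i ∈ Finset.range M, |U 0 (i + 1) - U 0 i| ≤ R) (N : ℕ) :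
    ∑ i ∈ Finset.range M, U 0 i ^ 2 / 2 - ∑ i ∈ Finset.range M, U N i ^ 2 / 2
      ≤ N * ((2 * C + R) * B) := by
  have level_le (n : ℕ) :
      -∑ i ∈ Finset.range M, U 0 i * (Y n (i + 1) - Y n i) ≤ (2 * C + R) * B :=
    (neg_le_abs _).trans (abs_sum_mul_sub_le hU (hY n) hR)
  have telescope (i : ℕ) :
      U N i - U 0 i = ∑ n ∈ Finset.range N, (Y n (i + 1) - Y n i) := by
    rw [← Finset.sum_range_sub (fun n => U n i)]
    exact Finset.sum_congr rfl fun n _ => hcons n i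
  calc ∑ i ∈ Finset.range M, U 0 i ^ 2 / 2 - ∑ i ∈ Finset.range M, U N i ^ 2 / 2
      ≤ ∑ i ∈ Finset.range M, -(U 0 i * (U N i - U 0 i)) := by
        rw [← Finset.sum_sub_distrib]
        exact Finset.sum_le_sum fun i _ => by linarith [sq_nonneg (U N i - U 0 i)]
    _ = ∑ n ∈ Finset.range N, -∑ i ∈ Finset.range M, U 0 i * (Y n (i + 1) - Y n i) := by
        simp only [telescope, Finset.mul_sum, Finset.sum_neg_distrib]
        rw [Finset.sum_comm]
    _ ≤ ∑ _n ∈ Finset.range N, (2 * C + R) * B := Finset.sum_le_sum fun n _ => level_le n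
    _ = N * ((2 * C + R) * B) := by rw [Finset.sum_const, Finset.card_range, nsmul_eq_mul]

theorem sum_dissipation_le {U Y Q D r : ℕ → ℕ → ℝ} {C B BQ Br R : ℝ} {M : ℕ}
    (hcell : ∀ n i, U (n + 1) i ^ 2 / 2 - (U n i ^ 2 + U n (i + 1) ^ 2) / 4 + Q n (i + 1) - Q n i
      ≤ -D n i + r n i)
    (hcons : ∀ n i, U (n + 1) i - U n i = Y n (i + 1) - Y n i) (hU : ∀ n i, |U n i| ≤ C)
    (hQ : ∀ n i, |Q n i| ≤ BQ) (hY : ∀ n i, |Y n i| ≤ B)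
    (hr : ∀ n, ∑ i ∈ Finset.range M, r n i ≤ Br)
    (hR : ∑ i ∈ Finset.range M, |U 0 (i + 1) - U 0 i| ≤ R) (N : ℕ) :
    ∑ n ∈ Finset.range N, ∑ i ∈ Finset.range M, D n i
      ≤ N * ((2 * C + R) * B + (C ^ 2 / 4 + 2 * BQ + Br)) := by
  let E (n : ℕ) : ℝ := ∑ i ∈ Finset.range M, U n i ^ 2 / 2
  calc ∑ n ∈ Finset.range N, ∑ i ∈ Finset.range M, D n i
      ≤ ∑ n ∈ Finset.range N, (E n - E (n + 1) + (C ^ 2 / 4 + 2 * BQ + Br)) :=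
        Finset.sum_le_sum fun n _ => by
          linarith [sum_dissipation_le_energy_sub M (hcell n) (hU n) (hQ n), hr n]
    _ = E 0 - E N + N * (C ^ 2 / 4 + 2 * BQ + Br) := by
        rw [Finset.sum_add_distrib, Finset.sum_range_sub', Finset.sum_const, Finset.card_range,
          nsmul_eq_mul]
    _ ≤ N * ((2 * C + R) * B + (C ^ 2 / 4 + 2 * BQ + Br)) := by
        linarith [energy_sub_le hcons (hU 0) hY hR N]

theorem sum_le_of_forall_window_sum_le {F : ℤ → ℝ} {c : ℝ} (hF : ∀ j, 0 ≤ F j)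
    (hwindow : ∀ (j₀ : ℤ) (M : ℕ), ∑ i ∈ Finset.range M, F (j₀ + i) ≤ c) (S : Finset ℤ) :
    ∑ j ∈ S, F j ≤ c := by
  let J := S.sup Int.natAbs
  have subset_window : S ⊆ (Finset.range (2 * J + 1)).image fun i : ℕ => -(J : ℤ) + i := by
    intro j hj
    have hjJ : j.natAbs ≤ J := Finset.le_sup (f := Int.natAbs) hj
    rw [Finset.mem_image]
    exact ⟨(j + J).toNat, by rw [Finset.mem_range]; omega, by omega⟩
  calc ∑ j ∈ S, F j ≤ ∑ j ∈ (Finset.range (2 * J + 1)).image fun i : ℕ => -(J : ℤ) + i, F j :=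
        Finset.sum_le_sum_of_subset_of_nonneg subset_window fun j _ _ => hF j
    _ = ∑ i ∈ Finset.range (2 * J + 1), F (-(J : ℤ) + i) :=
        Finset.sum_image fun _ _ _ _ h => Nat.cast_injective (add_left_cancel h)
    _ ≤ c := hwindow _ _

theorem summable_and_sum_tsum_le_of_window {F : ℕ → ℤ → ℝ} {A : ℝ} (hF : ∀ n j, 0 ≤ F n j)
    (hwindow : ∀ (j₀ : ℤ) (M N : ℕ),
      ∑ n ∈ Finset.range N, ∑ i ∈ Finset.range M, F n (j₀ + i) ≤ N * A) :
    (∀ n, Summable (F n)) ∧ ∀ N : ℕ, ∑ n ∈ Finset.range N, ∑' j, F n j ≤ N * A := by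
  have finset_sum_le (N : ℕ) (S : Finset ℤ) : ∑ j ∈ S, ∑ n ∈ Finset.range N, F n j ≤ N * A :=
    sum_le_of_forall_window_sum_le (fun j => Finset.sum_nonneg fun n _ => hF n j)
      (fun j₀ M => Finset.sum_comm.trans_le (hwindow j₀ M N)) S
  have summable (n : ℕ) : Summable (F n) :=
    summable_of_sum_le (hF n) fun S => (Finset.sum_le_sum fun j _ =>
      Finset.single_le_sum (f := fun m => F m j) (fun m _ => hF m j)
        (Finset.self_mem_range_succ n)).trans (finset_sum_le (n + 1) S)
  refine ⟨summable, fun N => ?_⟩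
  rw [← Summable.tsum_finsetSum fun n _ => summable n]
  exact (summable_sum fun n _ => summable n).tsum_le_of_sum_le (finset_sum_le N)

theorem mul_floor_div_add_one_le {T lam dx : ℝ} (hT : 0 ≤ T) (hlam : 0 < lam) (hdx : 0 < dx) :
    dx * (⌊T / (lam * dx)⌋₊ + 1) ≤ T / lam + dx := by
  calc dx * (⌊T / (lam * dx)⌋₊ + 1) ≤ dx * (T / (lam * dx) + 1) := by
        gcongr
        exact Nat.floor_le (by positivity)
    _ = T / lam + dx := by field_simp

end Summation

section FluxFamilyScheme

variable {X : Type*} [PseudoMetricSpace X] {h p : X → ℝ → ℝ} {K : Set X} {a b κ : ℝ}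

/-- `v` solves the staggered scheme with fluxes `h (x n j)` for a grid coefficient `x` in `K` and
initial values in `[a, b]`. As in `sol`, entry `j` of level `n + 1` lies halfway between the entries
`j` and `j + 1` of level `n`. -/
structure IsStaggeredSolution (h p : X → ℝ → ℝ) (K : Set X) (a b : ℝ) (x : ℕ → ℤ → X)
    (v : ℕ → ℤ → ℝ) : Prop where
  coeff_mem : ∀ n j, x n j ∈ K
  initial_mem : ∀ j, v 0 j ∈ Icc a b
  succ_eq : ∀ n j, v (n + 1) j = v n j
    + numFlux (h (x n (j + 1))) (p (x n (j + 1))) (v n (j + 1), slope (v n) (j + 1))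
    - numFlux (h (x n j)) (p (x n j)) (v n j, slope (v n) j)

namespace IsStaggeredSolution

variable {x : ℕ → ℤ → X} {v : ℕ → ℤ → ℝ}

theorem mem_Icc (S : IsStaggeredSolution h p K a b x v) (H : IsCFLFluxFamily h p K a b κ) (n : ℕ) :
    ∀ j, v n j ∈ Icc a b := by
  induction n with
  | zero => exact S.initial_mem
  | succ n ih =>
    intro j
    rw [S.succ_eq]
    have hx := S.coeff_mem n
    exact add_numFlux_sub_mem_Icc (H.isCFLFlux _ (hx j)) (H.isCFLFlux _ (hx (j + 1)))
      (H.eq_left _ (hx j) _ (hx (j + 1))) (H.eq_right _ (hx j) _ (hx (j + 1)))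
      (mk_slope_mem_nodeStates ih j) (mk_slope_mem_nodeStates ih (j + 1))

end IsStaggeredSolution

theorem IsCFLFluxFamily.exists_sum_dissipation_le (H : IsCFLFluxFamily h p K a b κ) (RX R : ℝ) :
    ∃ A, ∀ x v, IsStaggeredSolution h p K a b x v →
      (∀ n j₀ M, ∑ i ∈ Finset.range M, dist (x n (j₀ + i + 1)) (x n (j₀ + i)) ≤ RX) →
      (∀ j₀ M, ∑ i ∈ Finset.range M, |diff (v 0) (j₀ + i)| ≤ R) →
      ∀ (j₀ : ℤ) (M N : ℕ),
        ∑ n ∈ Finset.range N, ∑ i ∈ Finset.range M, dissipation (v n) (j₀ + i) ≤ N * A := by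
  obtain ⟨Λ, hΛ, hcell⟩ := H.exists_cell_energy_le
  obtain ⟨BQ, -, hQ⟩ := H.boundedLipschitzOn_entropyFlux
  obtain ⟨B, -, hY⟩ := H.boundedLipschitzOn_numFlux
  let C := max |a| |b|
  refine ⟨50 * ((2 * C + R) * B + (C ^ 2 / 4 + 2 * BQ + Λ * RX)),
    fun x v S hvar hvar₀ j₀ M N => ?_⟩
  have hx := S.coeff_mem
  have state_mem (n : ℕ) (j : ℤ) := mk_slope_mem_nodeStates (S.mem_Icc H n) j
  have cell_energy_le (n : ℕ) (j : ℤ) :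
      v (n + 1) j ^ 2 / 2 - (v n j ^ 2 + v n (j + 1) ^ 2) / 4
        + entropyFlux (h (x n (j + 1))) (p (x n (j + 1))) a (v n (j + 1), slope (v n) (j + 1))
        - entropyFlux (h (x n j)) (p (x n j)) a (v n j, slope (v n) j)
      ≤ -(1 / 50 * dissipation (v n) j) + Λ * dist (x n (j + 1)) (x n j) := by
    obtain ⟨t, ht, hσ₀⟩ := exists_slope_eq_mul_diff (v n) j
    obtain ⟨s, hs, hσ₁⟩ := exists_slope_succ_eq_mul_diff (v n) j
    rw [S.succ_eq, dissipation, ← neg_mul]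
    exact hcell _ (hx n j) _ (hx n (j + 1)) _ (state_mem n j) _ (state_mem n (j + 1)) t ht s hs
      hσ₀ hσ₁
  have total := sum_dissipation_le (M := M) (U := fun n i => v n (j₀ + i))
    (Y := fun n i => numFlux (h (x n (j₀ + i))) (p (x n (j₀ + i)))
      (v n (j₀ + i), slope (v n) (j₀ + i)))
    (Q := fun n i => entropyFlux (h (x n (j₀ + i))) (p (x n (j₀ + i))) a
      (v n (j₀ + i), slope (v n) (j₀ + i)))
    (D := fun n i => 1 / 50 * dissipation (v n) (j₀ + i))
    (r := fun n i => Λ * dist (x n (j₀ + i + 1)) (x n (j₀ + i)))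
    (C := C) (B := B) (BQ := BQ) (Br := Λ * RX) (R := R)
    (fun n i => by simpa only [Nat.cast_succ, ← add_assoc] using cell_energy_le n (j₀ + i))
    (fun n i => by rw [S.succ_eq, Nat.cast_succ, ← add_assoc]; ring)
    (fun n i => abs_fst_le_of_mem_nodeStates (state_mem n (j₀ + i)))
    (fun n i => (hQ _ (state_mem n (j₀ + i)) _ (hx n _)).1)
    (fun n i => (hY _ (state_mem n (j₀ + i)) _ (hx n _)).1)
    (fun n => by rw [← Finset.mul_sum]; exact mul_le_mul_of_nonneg_left (hvar n j₀ M) hΛ)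
    (by simpa only [Nat.cast_succ, ← add_assoc, diff] using hvar₀ j₀ M) N
  simp only [← Finset.mul_sum] at total
  linarith

end FluxFamilyScheme

section FluxHypotheses

variable {f : ℝ → ℝ → ℝ} {kMin kMax uMin uMax γ₁ γ₂ lam κ : ℝ}

theorem eq_add_div_mul_of_iteratedDerivWithin_two_eq_zero {g : ℝ → ℝ} {a b x : ℝ}
    (hg : ContDiffOn ℝ 2 g (Icc a b))
    (hzero : ∀ y ∈ Icc a b, iteratedDerivWithin 2 g (Icc a b) y = 0) (hx : x ∈ Icc a b) :
    g x = g a + (x - a) / (b - a) * (g b - g a) := by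
  have hab : a ≤ b := hx.1.trans hx.2
  rcases hab.eq_or_lt with rfl | hlt
  · rw [le_antisymm hx.2 hx.1]
    simp
  have taylor (y : ℝ) (hy : y ∈ Icc a b) :
      g y = g a + (y - a) * derivWithin g (Icc a b) a := by
    have hle := taylor_mean_remainder_bound (n := 1) (C := 0) hab (by exact_mod_cast hg) hy
      fun z hz => by simp [hzero z hz]
    simp only [zero_mul, zero_div, norm_le_zero_iff, sub_eq_zero] at hle
    rw [hle, taylorWithinEval_succ, taylor_within_zero_eval, iteratedDerivWithin_one]
    simp
  rw [taylor x hx, taylor b (right_mem_Icc.2 hab)]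
  have := (sub_pos.2 hlt).ne'
  field_simp
  ring

theorem isSubgradientOn_of_monotoneOn {h p : ℝ → ℝ} {s : Set ℝ} (hs : Convex ℝ s)
    (hderiv : ∀ x ∈ s, HasDerivWithinAt h (p x) s x) (hp : MonotoneOn p s) :
    IsSubgradientOn h p s := by
  have deriv_eq (x : ℝ) (hx : x ∈ interior s) : HasDerivAt h (p x) x :=
    (hderiv x (interior_subset hx)).hasDerivAt (mem_interior_iff_mem_nhds.1 hx)
  have convex : ConvexOn ℝ s h := by
    refine MonotoneOn.convexOn_of_deriv hs (fun x hx => (hderiv x hx).continuousWithinAt)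
      (fun x hx => (deriv_eq x hx).differentiableAt.differentiableWithinAt) ?_
    exact (hp.mono interior_subset).congr fun x hx => (deriv_eq x hx).deriv.symm
  intro x hx y hy
  rcases lt_trichotomy x y with hlt | rfl | hgt
  · have hle := convex.le_slope_of_hasDerivWithinAt hx hy hlt (hderiv x hx)
    rw [slope_def_field, le_div_iff₀ (sub_pos.2 hlt)] at hle
    linarith
  · simp
  · have hle := convex.slope_le_of_hasDerivWithinAt hy hx hgt (hderiv x hx)
    rw [slope_def_field, div_le_iff₀ (sub_pos.2 hgt)] at hle
    linarith

/-- The properties of the flux that the estimate relies on. Compared with `FluxHyp`, the flux and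
its `u`-derivative need only be Lipschitz in the coefficient instead of affine, and the flux is only
twice differentiable in `u`. -/
structure LipschitzFlux (f : ℝ → ℝ → ℝ) (kMin kMax uMin uMax γ₁ γ₂ : ℝ) : Prop where
  differentiableOn : ∀ k ∈ Icc kMin kMax, DifferentiableOn ℝ (f k) (Icc uMin uMax)
  gamma_pos : 0 < γ₁
  fuu_mem : ∀ k ∈ Icc kMin kMax, ∀ u ∈ Icc uMin uMax, fluxUU f uMin uMax k u ∈ Icc γ₁ γ₂
  boundedLipschitzOn : BoundedLipschitzOn f (Icc kMin kMax) (Icc uMin uMax)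
  boundedLipschitzOn_fluxU : BoundedLipschitzOn (fluxU f uMin uMax) (Icc kMin kMax) (Icc uMin uMax)
  eq_at_max : ∀ k₁ ∈ Icc kMin kMax, ∀ k₂ ∈ Icc kMin kMax, f k₁ uMax = f k₂ uMax
  eq_at_min : ∀ k₁ ∈ Icc kMin kMax, ∀ k₂ ∈ Icc kMin kMax, f k₁ uMin = f k₂ uMin

theorem fluxUU_eq_derivWithin (f : ℝ → ℝ → ℝ) (uMin uMax k u : ℝ) :
    fluxUU f uMin uMax k u = derivWithin (fluxU f uMin uMax k) (Icc uMin uMax) u := by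
  rw [fluxUU, iteratedDerivWithin_succ, iteratedDerivWithin_one]
  rfl

theorem hasDerivWithinAt_fluxU_of_fluxUU_ne_zero {k u : ℝ} (h : fluxUU f uMin uMax k u ≠ 0) :
    HasDerivWithinAt (fluxU f uMin uMax k) (fluxUU f uMin uMax k u) (Icc uMin uMax) u := by
  rw [fluxUU_eq_derivWithin] at h ⊢
  exact (differentiableWithinAt_of_derivWithin_ne_zero h).hasDerivWithinAt

namespace LipschitzFlux

variable {k u v : ℝ}

theorem gamma₂_pos (hf : LipschitzFlux f kMin kMax uMin uMax γ₁ γ₂) (hk : k ∈ Icc kMin kMax)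
    (hu : u ∈ Icc uMin uMax) : 0 < γ₂ :=
  hf.gamma_pos.trans_le ((hf.fuu_mem k hk u hu).1.trans (hf.fuu_mem k hk u hu).2)

theorem hasDerivWithinAt_fluxU (hf : LipschitzFlux f kMin kMax uMin uMax γ₁ γ₂)
    (hk : k ∈ Icc kMin kMax) (hu : u ∈ Icc uMin uMax) :
    HasDerivWithinAt (fluxU f uMin uMax k) (fluxUU f uMin uMax k u) (Icc uMin uMax) u :=
  hasDerivWithinAt_fluxU_of_fluxUU_ne_zero (hf.gamma_pos.trans_le (hf.fuu_mem k hk u hu).1).ne'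

theorem mul_sub_le_fluxU_sub (hf : LipschitzFlux f kMin kMax uMin uMax γ₁ γ₂)
    (hk : k ∈ Icc kMin kMax) (hu : u ∈ Icc uMin uMax) (hv : v ∈ Icc uMin uMax) (huv : u ≤ v) :
    γ₁ * (v - u) ≤ fluxU f uMin uMax k v - fluxU f uMin uMax k u := by
  have deriv_eq (x : ℝ) (hx : x ∈ interior (Icc uMin uMax)) :
      HasDerivAt (fluxU f uMin uMax k) (fluxUU f uMin uMax k x) x :=
    (hf.hasDerivWithinAt_fluxU hk (interior_subset hx)).hasDerivAt
      (mem_interior_iff_mem_nhds.1 hx)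
  refine (convex_Icc uMin uMax).mul_sub_le_image_sub_of_le_deriv
    (fun x hx => (hf.hasDerivWithinAt_fluxU hk hx).continuousWithinAt)
    (fun x hx => (deriv_eq x hx).differentiableAt.differentiableWithinAt)
    (fun x hx => ?_) u hu v hv huv
  rw [(deriv_eq x hx).deriv]
  exact (hf.fuu_mem k hk x (interior_subset hx)).1

theorem mul_abs_sub_le_abs_fluxU_sub (hf : LipschitzFlux f kMin kMax uMin uMax γ₁ γ₂)
    (hk : k ∈ Icc kMin kMax) (hu : u ∈ Icc uMin uMax) (hv : v ∈ Icc uMin uMax) :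
    γ₁ * |v - u| ≤ |fluxU f uMin uMax k v - fluxU f uMin uMax k u| := by
  wlog huv : u ≤ v
  · rw [abs_sub_comm, abs_sub_comm (fluxU f uMin uMax k v)]
    exact this hf hk hv hu (le_of_not_ge huv)
  rw [abs_of_nonneg (sub_nonneg.2 huv)]
  exact (hf.mul_sub_le_fluxU_sub hk hu hv huv).trans (le_abs_self _)

theorem abs_fluxU_sub_le (hf : LipschitzFlux f kMin kMax uMin uMax γ₁ γ₂)
    (hk : k ∈ Icc kMin kMax) (hu : u ∈ Icc uMin uMax) (hv : v ∈ Icc uMin uMax) :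
    |fluxU f uMin uMax k v - fluxU f uMin uMax k u| ≤ γ₂ * |v - u| := by
  refine (convex_Icc uMin uMax).norm_image_sub_le_of_norm_hasDerivWithin_le
    (fun x hx => hf.hasDerivWithinAt_fluxU hk hx) (fun x hx => ?_) hu hv
  have hmem := hf.fuu_mem k hk x hx
  rw [Real.norm_of_nonneg (hf.gamma_pos.le.trans hmem.1)]
  exact hmem.2

theorem isSubgradientOn (hf : LipschitzFlux f kMin kMax uMin uMax γ₁ γ₂)
    (hk : k ∈ Icc kMin kMax) :
    IsSubgradientOn (f k) (fluxU f uMin uMax k) (Icc uMin uMax) := by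
  refine isSubgradientOn_of_monotoneOn (convex_Icc uMin uMax)
    (fun u hu => (hf.differentiableOn k hk u hu).hasDerivWithinAt) fun u hu v hv huv => ?_
  exact sub_nonneg.1 ((mul_nonneg hf.gamma_pos.le (sub_nonneg.2 huv)).trans
    (hf.mul_sub_le_fluxU_sub hk hu hv huv))

theorem isCFLFluxFamily (hf : LipschitzFlux f kMin kMax uMin uMax γ₁ γ₂) (hlam : 0 ≤ lam)
    (hcfl : ∀ k ∈ Icc kMin kMax, ∀ u ∈ Icc uMin uMax, lam * |fluxU f uMin uMax k u| ≤ κ)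
    (hκ : κ ≤ 1 / 200) (hκγ : κ * γ₂ ≤ γ₁ / 2) :
    IsCFLFluxFamily (fun k u => lam * f k u) (fun k u => lam * fluxU f uMin uMax k u)
      (Icc kMin kMax) uMin uMax κ where
  isCFLFlux k hk :=
    { kappa_le := hκ
      isSubgradientOn := fun u hu v hv => by
        linarith [mul_le_mul_of_nonneg_left (hf.isSubgradientOn hk u hu v hv) hlam]
      abs_deriv_le := fun u hu => by
        rw [abs_mul, abs_of_nonneg hlam]
        exact hcfl k hk u hu
      slow_variation := fun u hu v hv m hm hle => by
        have hγ₂ := (hf.gamma₂_pos hk hu).le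
        rw [← mul_sub, ← mul_sub, abs_mul, abs_mul, abs_of_nonneg hlam, mul_div_assoc]
        gcongr
        calc |fluxU f uMin uMax k m - fluxU f uMin uMax k u|
            ≤ γ₂ * |m - u| := hf.abs_fluxU_sub_le hk hu hm
          _ ≤ γ₂ * (κ / 2 * |v - u|) := by gcongr
          _ = κ * γ₂ / 2 * |v - u| := by ring
          _ ≤ γ₁ / 2 / 2 * |v - u| := by gcongr
          _ ≤ |fluxU f uMin uMax k v - fluxU f uMin uMax k u| / 4 := by
            linarith [hf.mul_abs_sub_le_abs_fluxU_sub hk hu hv] }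
  boundedLipschitzOn_flux := hf.boundedLipschitzOn.const_mul lam
  boundedLipschitzOn_deriv := hf.boundedLipschitzOn_fluxU.const_mul lam
  eq_left k₁ hk₁ k₂ hk₂ := congrArg (lam * ·) (hf.eq_at_min k₁ hk₁ k₂ hk₂)
  eq_right k₁ hk₁ k₂ hk₂ := congrArg (lam * ·) (hf.eq_at_max k₁ hk₁ k₂ hk₂)

end LipschitzFlux

namespace FluxHyp

variable {k u : ℝ}

theorem eq_add_div_mul (hf : FluxHyp f kMin kMax uMin uMax γ₁ γ₂) (hk : k ∈ Icc kMin kMax)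
    (hu : u ∈ Icc uMin uMax) :
    f k u = f kMin u + (k - kMin) / (kMax - kMin) * (f kMax u - f kMin u) :=
  eq_add_div_mul_of_iteratedDerivWithin_two_eq_zero (hf.smooth_k u hu) (hf.fkk_zero u hu) hk

theorem hasDerivWithinAt (hf : FluxHyp f kMin kMax uMin uMax γ₁ γ₂) (hk : k ∈ Icc kMin kMax)
    (hu : u ∈ Icc uMin uMax) :
    HasDerivWithinAt (f k) (fluxU f uMin uMax k u) (Icc uMin uMax) u :=
  ((hf.smooth_u k hk).differentiableOn (by norm_num) u hu).hasDerivWithinAt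

theorem fluxUU_ne_zero (hf : FluxHyp f kMin kMax uMin uMax γ₁ γ₂) (hk : k ∈ Icc kMin kMax)
    (hu : u ∈ Icc uMin uMax) : fluxUU f uMin uMax k u ≠ 0 :=
  (hf.gamma_pos.trans_le (hf.fuu_bounds k hk u hu).1).ne'

theorem fluxU_eq_add_div_mul (hf : FluxHyp f kMin kMax uMin uMax γ₁ γ₂) (hk : k ∈ Icc kMin kMax)
    (hu : u ∈ Icc uMin uMax) :
    fluxU f uMin uMax k u = fluxU f uMin uMax kMin u + (k - kMin) / (kMax - kMin) *
      (fluxU f uMin uMax kMax u - fluxU f uMin uMax kMin u) := by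
  have hkk : kMin ≤ kMax := hk.1.trans hk.2
  have left := hf.hasDerivWithinAt (left_mem_Icc.2 hkk) hu
  have right := hf.hasDerivWithinAt (right_mem_Icc.2 hkk) hu
  have unique : UniqueDiffWithinAt ℝ (Icc uMin uMax) u := by
    by_contra hnot
    refine hf.fluxUU_ne_zero hk hu ?_
    rw [fluxUU_eq_derivWithin, derivWithin_zero_of_not_uniqueDiffWithinAt hnot]
  exact ((left.add ((right.sub left).const_mul ((k - kMin) / (kMax - kMin)))).congr
    (fun y hy => hf.eq_add_div_mul hk hy) (hf.eq_add_div_mul hk hu)).derivWithin unique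

theorem lipschitzFlux (hf : FluxHyp f kMin kMax uMin uMax γ₁ γ₂) (hk : kMin ≤ kMax) :
    LipschitzFlux f kMin kMax uMin uMax γ₁ γ₂ := by
  have bounded {φ : ℝ → ℝ} (hφ : ContinuousOn φ (Icc uMin uMax)) :
      ∃ B, ∀ u ∈ Icc uMin uMax, |φ u| ≤ B := isCompact_Icc.exists_bound_of_continuousOn hφ
  have affine_boundedLipschitzOn {G : ℝ → ℝ → ℝ}
      (hG : ∀ k ∈ Icc kMin kMax, ∀ u ∈ Icc uMin uMax,
        G k u = G kMin u + (k - kMin) / (kMax - kMin) * (G kMax u - G kMin u))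
      (hcont : ∀ k ∈ Icc kMin kMax, ContinuousOn (G k) (Icc uMin uMax)) :
      BoundedLipschitzOn G (Icc kMin kMax) (Icc uMin uMax) := by
    obtain ⟨B, hB⟩ := bounded (hcont kMin (left_mem_Icc.2 hk))
    obtain ⟨B', hB'⟩ := bounded (hcont kMax (right_mem_Icc.2 hk))
    exact .of_affine (B := max B B') hG (fun u hu => (hB u hu).trans (le_max_left _ _))
      fun u hu => (hB' u hu).trans (le_max_right _ _)
  exact
    { differentiableOn := fun k hk => (hf.smooth_u k hk).differentiableOn (by norm_num)
      gamma_pos := hf.gamma_pos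
      fuu_mem := hf.fuu_bounds
      boundedLipschitzOn := affine_boundedLipschitzOn (fun k hk u hu => hf.eq_add_div_mul hk hu)
        fun k hk => (hf.smooth_u k hk).continuousOn
      boundedLipschitzOn_fluxU := affine_boundedLipschitzOn
        (fun k hk u hu => hf.fluxU_eq_add_div_mul hk hu) fun k hk u hu =>
          (hasDerivWithinAt_fluxU_of_fluxUU_ne_zero (hf.fluxUU_ne_zero hk hu)).continuousWithinAt
      eq_at_max := hf.eq_at_max
      eq_at_min := hf.eq_at_min }

end FluxHyp

end FluxHypotheses

section StaggeredScheme

variable {f : ℝ → ℝ → ℝ} {k u₀ : ℝ → ℝ} {kMin kMax uMin uMax γ₁ γ₂ lam κ dx : ℝ}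

theorem HasBV.exists_sum_abs_diff_coeff_le {w : ℝ → ℝ} (hw : HasBV w) :
    ∃ R, ∀ dx, 0 < dx → ∀ n (j₀ : ℤ) (M : ℕ),
      ∑ i ∈ Finset.range M, |diff (coeff w dx n) (j₀ + i)| ≤ R := by
  obtain ⟨R, hR⟩ := hw.exists_sum_abs_cellAvg_sub_le
  refine ⟨R, fun dx hdx n j₀ M => (Finset.sum_congr rfl fun i _ => ?_).trans_le
    (hR dx hdx (j₀ + n / 2) M)⟩
  simp only [diff, coeff]
  push_cast
  ring_nf

theorem coeff_mem_Icc {w : ℝ → ℝ} {a b : ℝ} (hw : HasBV w) (hmem : ∀ᵐ x, w x ∈ Icc a b)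
    (hdx : 0 < dx) (n : ℕ) (j : ℤ) : coeff w dx n j ∈ Icc a b :=
  cellAvg_mem hw (convex_Icc a b) isClosed_Icc hmem hdx _

theorem sol_zero (f : ℝ → ℝ → ℝ) (uMin uMax : ℝ) (k u₀ : ℝ → ℝ) (lam dx : ℝ) :
    sol f uMin uMax k u₀ lam dx 0 = coeff u₀ dx 0 := by
  ext j
  simp [sol, coeff]

theorem step_eq_add_numFlux_sub (f : ℝ → ℝ → ℝ) (uMin uMax lam : ℝ) (kk v : ℤ → ℝ) (j : ℤ) :
    step f uMin uMax lam kk v j = v j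
      + numFlux (fun u => lam * f (kk (j + 1)) u)
          (fun u => lam * fluxU f uMin uMax (kk (j + 1)) u) (v (j + 1), slope v (j + 1))
      - numFlux (fun u => lam * f (kk j) u)
          (fun u => lam * fluxU f uMin uMax (kk j) u) (v j, slope v j) := by
  have midVal_eq (i : ℤ) : midVal (fun u => lam * fluxU f uMin uMax (kk i) u) (v i, slope v i)
      = midValue f uMin uMax lam kk v i := by
    simp only [midVal, midValue]
    ring
  simp only [step, numFlux, midVal_eq]
  ring

theorem isStaggeredSolution_sol (hk_bv : HasBV k) (hk_mem : ∀ᵐ x, k x ∈ Icc kMin kMax)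
    (hu_bv : HasBV u₀) (hu_mem : ∀ᵐ x, u₀ x ∈ Icc uMin uMax) (hdx : 0 < dx) :
    IsStaggeredSolution (fun k u => lam * f k u) (fun k u => lam * fluxU f uMin uMax k u)
      (Icc kMin kMax) uMin uMax (coeff k dx) (sol f uMin uMax k u₀ lam dx) where
  coeff_mem := coeff_mem_Icc hk_bv hk_mem hdx
  initial_mem := by
    rw [sol_zero]
    exact coeff_mem_Icc hu_bv hu_mem hdx 0
  succ_eq _ _ := step_eq_add_numFlux_sub _ _ _ _ _ _ _

namespace LipschitzFlux

theorem nu_bounds (hf : LipschitzFlux f kMin kMax uMin uMax γ₁ γ₂)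
    (H : IsCFLFluxFamily (fun k u => lam * f k u) (fun k u => lam * fluxU f uMin uMax k u)
      (Icc kMin kMax) uMin uMax κ)
    (hk_bv : HasBV k) (hk_mem : ∀ᵐ x, k x ∈ Icc kMin kMax)
    (hu_bv : HasBV u₀) (hu_mem : ∀ᵐ x, u₀ x ∈ Icc uMin uMax) (hdx : 0 < dx) (n : ℕ) (j : ℤ) :
    0 ≤ nu f uMin uMax k u₀ lam dx n j ∧
      nu f uMin uMax k u₀ lam dx n j * diff (sol f uMin uMax k u₀ lam dx n) j ^ 2
        ≤ γ₂ / 4 * dissipation (sol f uMin uMax k u₀ lam dx n) j := by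
  have midpoint_mem {a b x y : ℝ} (hx : x ∈ Icc a b) (hy : y ∈ Icc a b) :
      (x + y) / 2 ∈ Icc a b := ⟨by linarith [hx.1, hy.1], by linarith [hx.2, hy.2]⟩
  have mem := (isStaggeredSolution_sol hk_bv hk_mem hu_bv hu_mem hdx).mem_Icc H n
  have coeff_mem := coeff_mem_Icc hk_bv hk_mem hdx n
  have state_mem := midpoint_mem (mem j) (mem (j + 1))
  have flux := H.isCFLFlux _ (midpoint_mem (coeff_mem j) (coeff_mem (j + 1)))
  have fuu_mem := hf.fuu_mem _
    (cellAvg_mem hk_bv (convex_Icc kMin kMax) isClosed_Icc hk_mem hdx (j + n / 2 + 1 / 2)) _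
    state_mem
  exact weight_bounds ((flux.abs_deriv_le _ state_mem).trans (by linarith [flux.kappa_le]))
    (hf.gamma_pos.le.trans fuu_mem.1) fuu_mem.2

theorem exists_sum_nu_mul_sq_diff_le (hf : LipschitzFlux f kMin kMax uMin uMax γ₁ γ₂)
    (H : IsCFLFluxFamily (fun k u => lam * f k u) (fun k u => lam * fluxU f uMin uMax k u)
      (Icc kMin kMax) uMin uMax κ)
    (hk_bv : HasBV k) (hk_mem : ∀ᵐ x, k x ∈ Icc kMin kMax)
    (hu_bv : HasBV u₀) (hu_mem : ∀ᵐ x, u₀ x ∈ Icc uMin uMax) :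
    ∃ A, ∀ dx, 0 < dx → ∀ (j₀ : ℤ) (M N : ℕ),
      ∑ n ∈ Finset.range N, ∑ i ∈ Finset.range M, nu f uMin uMax k u₀ lam dx n (j₀ + i) *
        diff (sol f uMin uMax k u₀ lam dx n) (j₀ + i) ^ 2 ≤ N * A := by
  obtain ⟨RX, hRX⟩ := hk_bv.exists_sum_abs_diff_coeff_le
  obtain ⟨R, hR⟩ := hu_bv.exists_sum_abs_diff_coeff_le
  obtain ⟨A, hA⟩ := H.exists_sum_dissipation_le RX R
  obtain ⟨k', hk'⟩ := hk_mem.exists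
  obtain ⟨u, hu⟩ := hu_mem.exists
  have hγ₂ := (hf.gamma₂_pos hk' hu).le
  refine ⟨γ₂ / 4 * A, fun dx hdx j₀ M N => ?_⟩
  calc ∑ n ∈ Finset.range N, ∑ i ∈ Finset.range M, nu f uMin uMax k u₀ lam dx n (j₀ + i) *
        diff (sol f uMin uMax k u₀ lam dx n) (j₀ + i) ^ 2
      ≤ ∑ n ∈ Finset.range N, ∑ i ∈ Finset.range M,
          γ₂ / 4 * dissipation (sol f uMin uMax k u₀ lam dx n) (j₀ + i) :=
        Finset.sum_le_sum fun n _ => Finset.sum_le_sum fun i _ =>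
          (hf.nu_bounds H hk_bv hk_mem hu_bv hu_mem hdx n _).2
    _ = γ₂ / 4 * ∑ n ∈ Finset.range N, ∑ i ∈ Finset.range M,
          dissipation (sol f uMin uMax k u₀ lam dx n) (j₀ + i) := by
        simp only [Finset.mul_sum]
    _ ≤ γ₂ / 4 * (N * A) := by
        gcongr
        refine hA _ _ (isStaggeredSolution_sol hk_bv hk_mem hu_bv hu_mem hdx)
          (fun n j₀ M => hRX dx hdx n j₀ M) (fun j₀ M => ?_) j₀ M N
        rw [sol_zero]
        exact hR dx hdx 0 j₀ M
    _ = N * (γ₂ / 4 * A) := by ring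

end LipschitzFlux

theorem CFL.mul_gamma_le (hcfl : CFL f kMin kMax uMin uMax γ₁ γ₂ lam κ) (hγ₁ : 0 ≤ γ₁)
    (hγ₂ : 0 < γ₂) : κ * γ₂ ≤ γ₁ / 2 := by
  have hle := hcfl.2.1
  rw [le_div_iff₀ (by positivity)] at hle
  linarith

end StaggeredScheme

end NTScheme

end

theorem mainTheorem8_general
    (f : ℝ → ℝ → ℝ) (k u₀ : ℝ → ℝ) (kMin kMax uMin uMax γ₁ γ₂ lam κ : ℝ)
    (hk_mem : ∀ᵐ x, k x ∈ Set.Icc kMin kMax) (hk_bv : NTScheme.HasBV k)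
    (hf : NTScheme.LipschitzFlux f kMin kMax uMin uMax γ₁ γ₂)
    (hu_mem : ∀ᵐ x, u₀ x ∈ Set.Icc uMin uMax) (hu_bv : NTScheme.HasBV u₀)
    (hlam : 0 < lam)
    (hcfl : ∀ k ∈ Set.Icc kMin kMax, ∀ u ∈ Set.Icc uMin uMax,
      lam * |NTScheme.fluxU f uMin uMax k u| ≤ κ)
    (hκ : κ ≤ 1 / 200) (hκγ : κ * γ₂ ≤ γ₁ / 2) :
    (∀ dx : ℝ, 0 < dx → ∀ (n : ℕ) (j : ℤ), 0 ≤ NTScheme.nu f uMin uMax k u₀ lam dx n j) ∧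
    (∀ T : ℝ, 0 < T → ∀ dxMax : ℝ, 0 < dxMax →
      ∃ K : ℝ, ∀ dx : ℝ, 0 < dx → dx ≤ dxMax →
        (∀ n : ℕ, Summable fun j : ℤ =>
          NTScheme.nu f uMin uMax k u₀ lam dx n j *
            NTScheme.diff (NTScheme.sol f uMin uMax k u₀ lam dx n) j ^ 2) ∧
        dx * ∑ n ∈ Finset.range (⌊T / (lam * dx)⌋₊ + 1), ∑' j : ℤ,
          NTScheme.nu f uMin uMax k u₀ lam dx n j *
            NTScheme.diff (NTScheme.sol f uMin uMax k u₀ lam dx n) j ^ 2 ≤ K) := by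
  have H := hf.isCFLFluxFamily hlam.le hcfl hκ hκγ
  have nu_nonneg (dx : ℝ) (hdx : 0 < dx) (n : ℕ) (j : ℤ) :
      0 ≤ NTScheme.nu f uMin uMax k u₀ lam dx n j :=
    (hf.nu_bounds H hk_bv hk_mem hu_bv hu_mem hdx n j).1
  refine ⟨nu_nonneg, fun T hT dxMax hdxMax => ?_⟩
  obtain ⟨A, hA⟩ := hf.exists_sum_nu_mul_sq_diff_le H hk_bv hk_mem hu_bv hu_mem
  have hA_nonneg : 0 ≤ A := by simpa using hA dxMax hdxMax 0 0 1
  refine ⟨(T / lam + dxMax) * A, fun dx hdx hdx_le => ?_⟩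
  obtain ⟨summable, sum_tsum_le⟩ := NTScheme.summable_and_sum_tsum_le_of_window
    (fun n j => mul_nonneg (nu_nonneg dx hdx n j) (sq_nonneg _)) (hA dx hdx)
  refine ⟨summable, ?_⟩
  calc _ ≤ dx * ((⌊T / (lam * dx)⌋₊ + 1 : ℕ) * A) := by
        gcongr
        exact sum_tsum_le _
    _ = dx * (⌊T / (lam * dx)⌋₊ + 1) * A := by rw [Nat.cast_succ, mul_assoc]
    _ ≤ (T / lam + dxMax) * A := by
        gcongr
        linarith [NTScheme.mul_floor_div_add_one_le hT.le hlam hdx]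

theorem mainTheorem8
    (f : ℝ → ℝ → ℝ) (k u₀ : ℝ → ℝ) (kMin kMax uMin uMax γ₁ γ₂ lam κ : ℝ)
    (hk_le : kMin ≤ kMax) (hu_le : uMin ≤ uMax)
    (hk_mem : ∀ᵐ x ∂(MeasureTheory.volume : MeasureTheory.Measure ℝ), k x ∈ Set.Icc kMin kMax)
    (hk_bv : NTScheme.HasBV k)
    (hf : NTScheme.FluxHyp f kMin kMax uMin uMax γ₁ γ₂)
    (hu_mem : ∀ᵐ x ∂(MeasureTheory.volume : MeasureTheory.Measure ℝ), u₀ x ∈ Set.Icc uMin uMax)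
    (hu_bv : NTScheme.HasBV u₀)
    (hlam : 0 < lam)
    (hcfl : NTScheme.CFL f kMin kMax uMin uMax γ₁ γ₂ lam κ) :
    (∀ dx : ℝ, 0 < dx → ∀ (n : ℕ) (j : ℤ), 0 ≤ NTScheme.nu f uMin uMax k u₀ lam dx n j) ∧
    (∀ T : ℝ, 0 < T → ∀ dxMax : ℝ, 0 < dxMax →
      ∃ K : ℝ, ∀ dx : ℝ, 0 < dx → dx ≤ dxMax →
        (∀ n : ℕ, Summable fun j : ℤ =>
          NTScheme.nu f uMin uMax k u₀ lam dx n j *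
            NTScheme.diff (NTScheme.sol f uMin uMax k u₀ lam dx n) j ^ 2) ∧
        dx * ∑ n ∈ Finset.range (⌊T / (lam * dx)⌋₊ + 1), ∑' j : ℤ,
          NTScheme.nu f uMin uMax k u₀ lam dx n j *
            NTScheme.diff (NTScheme.sol f uMin uMax k u₀ lam dx n) j ^ 2 ≤ K) := by
  have hL := hf.lipschitzFlux hk_le
  exact mainTheorem8_general f k u₀ kMin kMax uMin uMax γ₁ γ₂ lam κ hk_mem hk_bv hL hu_mem hu_bv
    hlam hcfl.1 (hcfl.2.2.1.trans (by norm_num)) (hcfl.mul_gamma_le hf.gamma_pos.le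
      (hL.gamma₂_pos (Set.left_mem_Icc.2 hk_le) (Set.left_mem_Icc.2 hu_le)))
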